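/- Let $n$ be a natural number and let $\mathcal M_{2^n}=\mathcal M_2\otimes\cdots\otimes\mathcal M_2$ ($n$ factors) be the algebra of complex $2^n\times 2^n$ matrices, with normalized trace $\tau_n=2^{-n}\operatorname{tr}$. Let $U=\begin{pmatrix}1&0\\0&-1\end{pmatrix}$, $Q=\begin{pmatrix}0&1\\1&0\end{pmatrix}$, and for $1\le j\le n$ let $Q'_j=U\otimes\cdots\otimes U\otimes Q\otimes \mathrm{Id}\otimes\cdots\otimes \mathrm{Id}$, with $Q$ in the $j$-th factor. For $A=\{i_1<\dots<i_k\}\subset\{1,\dots,n\}$ let $Q'_A=Q'_{i_1}\cdots Q'_{i_k}$, with $Q'_\varnothing=\mathrm{Id}$, and let $M'_n$ be the (unital) *-algebra generated by $Q'_1,\dots,Q'_n$; the $Q'_A$ form a linear basis of it, orthonormal for $\langle S,T\rangle=\tau_n(S^*T)$. Let $D'_j$ be the linear map on $M'_n$ with $D'_j(Q'_A)=Q'_jQ'_A$ if $j\in A$ and $D'_j(Q'_A)=0$ otherwise; for $\alpha>0$ let $N'^{\alpha}$ be the linear map on $M'_n$ with $N'^{\alpha}(Q'_A)=|A|^{\alpha}Q'_A$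 (so $N'^\alpha(\mathrm{Id})=0$). Write $|S|=(S^*S)^{1/2}$, let $\|\cdot\|_{C_\infty}$ be the operator norm, and put $$|\nabla_sT|=\Big(\sum_{j=1}^n |D'_j(T)^*|^2+|D'_j(T)|^2\Big)^{1/2}.$$ For $0<\alpha<\frac12$ let $$K_\alpha=\frac1{\Gamma(1-\alpha)}\int_0^{\pi/2}(-\log\cos\theta)^{-\alpha}\,d\theta .$$ Let $T\in M'_n$. 1. For every $t\ge 0$, if $F$ denotes the spectral measure of $|T-\tau_n(T)\mathrm{Id}|$, $$\tau_n\big(F([t,\infty))\big)\le 2\exp\Big(-\frac{4t^2}{\pi^2\,\big\|\,|\nabla_sT|\,\big\|_{C_\infty}^2}\Big).$$ 2. Let $0<\alpha<\frac12$. Then $\theta\mapsto(-\log\cos\theta)^{-\alpha}$ is integrable on $[0,\frac\pi2]$ (so that $K_\alpha$ is finite), and for every $t\ge 0$, if $G_\alpha$ denotes the spectral measure of $|N'^{\alpha}T|$, $$\tau_n\big(G_\alpha([t,\infty))\big)\le 2\exp\Big(-\frac{t^2}{2K_\alpha^2\,\big\|\,|\nabla_sT|\,\big\|_{C_\infty}^2}\Big).$$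 Here, when $\|\,|\nabla_sT|\,\|_{C_\infty}=0$, the right-hand sides are read as $0$ for $t>0$ and as $2$ for $t=0$. -/

import Mathlib

open scoped MatrixOrder

noncomputable section

namespace CAR

/-- The matrix algebra `𝓜_{2^n}`, with rows and columns indexed by `{0,1}^n`, so that it is the
`n`-fold tensor power of the algebra of `2 × 2` matrices. -/
abbrev Mat (n : ℕ) : Type := Matrix (Fin n → Fin 2) (Fin n → Fin 2) ℂ

/-- The elementary tensor `A 0 ⊗ A 1 ⊗ ⋯ ⊗ A (n-1)` of `2 × 2` matrices. -/
def tensor {n : ℕ} (A : Fin n → Matrix (Fin 2) (Fin 2) ℂ) : Mat n :=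
  Matrix.of fun x y => ∏ i, A i (x i) (y i)

/-- The Pauli matrix `U`. -/
def pauliU : Matrix (Fin 2) (Fin 2) ℂ := !![1, 0; 0, -1]

/-- The Pauli matrix `Q`. -/
def pauliQ : Matrix (Fin 2) (Fin 2) ℂ := !![0, 1; 1, 0]

/-- The fermion `Q'_j = U ⊗ ⋯ ⊗ U ⊗ Q ⊗ Id ⊗ ⋯ ⊗ Id`, with `Q` in the factor `j`. -/
def fermion {n : ℕ} (j : Fin n) : Mat n :=
  tensor fun i => if i < j then pauliU else if i = j then pauliQ else 1

/-- `Q'_A`, the product of the fermions `Q'_i`, `i ∈ A`, in increasing order of `i`;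
`Q'_∅` is the identity. -/
def fermionProd {n : ℕ} (A : Finset (Fin n)) : Mat n :=
  ((A.sort (· ≤ ·)).map fermion).prod

/-- The CAR *-algebra `M'_n`: the unital *-subalgebra generated by the `n` fermions. -/
def algebra (n : ℕ) : StarSubalgebra ℂ (Mat n) :=
  StarAlgebra.adjoin ℂ (Set.range (fermion (n := n)))

/-- The normalized trace `τ_n`. -/
def tau {n : ℕ} (S : Mat n) : ℂ := S.trace / 2 ^ n

/-- The coefficient of `T` on `Q'_A`, i.e. the inner product `τ_n (Q'_A^* T)`. -/
def coeff {n : ℕ} (A : Finset (Fin n)) (T : Mat n) : ℂ := tau (star (fermionProd A) * T)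

/-- The annihilation operator `D'_j`: the linear map on the span of the `Q'_A` with
`D'_j Q'_A = Q'_j Q'_A` if `j ∈ A`, and `D'_j Q'_A = 0` otherwise. -/
def annihilate {n : ℕ} (j : Fin n) (T : Mat n) : Mat n :=
  ∑ A : Finset (Fin n), if j ∈ A then coeff A T • (fermion j * fermionProd A) else 0

/-- The power `N'^α` (for `α > 0`) of the number operator `N'`: the linear map on the span of
the `Q'_A` with `N'^α Q'_A = |A|^α Q'_A`. -/
def numberPow {n : ℕ} (α : ℝ) (T : Mat n) : Mat n :=
  ∑ A : Finset (Fin n), (((A.card : ℝ) ^ α : ℝ) : ℂ) • coeff A T • fermionProd A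

/-- The symmetrized length of the gradient,
`|∇_s T| = (∑_j |D'_j(T)^*|^2 + |D'_j(T)|^2)^{1/2}`. -/
def gradNorm {n : ℕ} (T : Mat n) : Mat n :=
  CFC.sqrt (∑ j : Fin n, (CFC.abs (star (annihilate j T)) ^ 2 + CFC.abs (annihilate j T) ^ 2))

/-- The norm of `C_∞`, i.e. the operator norm on the Hilbert space `ℂ^{2^n}`. -/
def normInf {n : ℕ} (S : Mat n) : ℝ := ‖Matrix.toEuclideanCLM (𝕜 := ℂ) S‖

/-- The spectral projection `1_{[t,∞)}(H)` of a Hermitian matrix `H`. The spectrum of `H` is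
finite, so every function is continuous on it and the functional calculus applies. -/
def specProj {n : ℕ} (t : ℝ) (H : Mat n) : Mat n :=
  cfc (Set.indicator (Set.Ici t) (fun _ : ℝ => (1 : ℝ))) H

/-- The function `θ ↦ (-log cos θ)^{-α}`. -/
def weight (α θ : ℝ) : ℝ := (-Real.log (Real.cos θ)) ^ (-α)

/-- The constant `K_α = ‖(-log cos θ)^{-α}‖_{L^1([0, π/2])} / Γ(1 - α)`. -/
def constK (α : ℝ) : ℝ :=
  1 / Real.Gamma (1 - α) * ∫ θ in (0 : ℝ)..(Real.pi / 2), |weight α θ|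

theorem tensor_mul {n : ℕ} (A B : Fin n → Matrix (Fin 2) (Fin 2) ℂ) :
    tensor A * tensor B = tensor (fun i => A i * B i) := by
  ext x y
  simp only [tensor, Matrix.mul_apply, Matrix.of_apply, Finset.prod_univ_sum,
    Fintype.piFinset_univ, Finset.prod_mul_distrib]

theorem tensor_one {n : ℕ} : tensor (fun _ : Fin n => (1 : Matrix (Fin 2) (Fin 2) ℂ)) = 1 := by
  ext x y
  simp only [tensor, Matrix.of_apply, Matrix.one_apply, Finset.prod_ite_zero, funext_iff]
  simp

theorem star_tensor {n : ℕ} (A : Fin n → Matrix (Fin 2) (Fin 2) ℂ) :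
    star (tensor A) = tensor (fun i => star (A i)) := by
  ext x y
  simp [tensor, Matrix.star_apply]

theorem U_mul_U : pauliU * pauliU = 1 := by
  ext i j; fin_cases i <;> fin_cases j <;> simp [pauliU, Matrix.mul_apply]

theorem Q_mul_Q : pauliQ * pauliQ = 1 := by
  ext i j; fin_cases i <;> fin_cases j <;> simp [pauliQ, Matrix.mul_apply]

theorem U_mul_Q : pauliU * pauliQ = -(pauliQ * pauliU) := by
  ext i j; fin_cases i <;> fin_cases j <;> simp [pauliU, pauliQ, Matrix.mul_apply]

theorem star_U : star pauliU = pauliU := by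
  ext i j; fin_cases i <;> fin_cases j <;> simp [pauliU, Matrix.star_apply]

theorem star_Q : star pauliQ = pauliQ := by
  ext i j; fin_cases i <;> fin_cases j <;> simp [pauliQ, Matrix.star_apply]

theorem star_fermion {n : ℕ} (j : Fin n) : star (fermion j) = fermion j := by
  rw [fermion, star_tensor]
  congr 1
  funext i
  split_ifs <;> simp [star_U, star_Q]

theorem fermion_mul_self {n : ℕ} (j : Fin n) : fermion j * fermion j = 1 := by
  rw [fermion, tensor_mul, ← tensor_one]
  congr 1
  funext i
  split_ifs <;> simp [U_mul_U, Q_mul_Q]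

/-- The matrix with `U` in the factor `j` and `Id` in the others. -/
def flipU {n : ℕ} (j : Fin n) : Mat n := tensor fun i => if i = j then pauliU else 1

theorem flip_mul_self {n : ℕ} (j : Fin n) : flipU j * flipU j = 1 := by
  rw [flipU, tensor_mul, ← tensor_one]
  congr 1
  funext i
  split_ifs <;> simp [U_mul_U]

theorem tensor_neg_at {n : ℕ} (A B : Fin n → Matrix (Fin 2) (Fin 2) ℂ) (j : Fin n)
    (h : ∀ i, i ≠ j → A i = B i) (hj : A j = -B j) : tensor A = -tensor B := by
  ext x y
  simp only [tensor, Matrix.of_apply, Matrix.neg_apply]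
  rw [← Finset.mul_prod_erase _ _ (Finset.mem_univ j),
    ← Finset.mul_prod_erase (a := j) _ (fun i => B i (x i) (y i)) (Finset.mem_univ j), hj]
  rw [Finset.prod_congr rfl (g := fun i => B i (x i) (y i))
    (fun i hi => by rw [h i (Finset.ne_of_mem_erase hi)])]
  simp

theorem flip_mul_fermion {n : ℕ} (j k : Fin n) :
    flipU j * fermion k = (if k = j then (-1 : ℂ) else 1) • (fermion k * flipU j) := by
  rw [flipU, fermion, tensor_mul, tensor_mul]
  split_ifs with hk
  · subst hk
    rw [neg_one_smul]
    apply tensor_neg_at _ _ k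
    · intro i hi; simp [hi]
    · simp [U_mul_Q]
  · rw [one_smul]
    congr 1
    funext i
    by_cases hi : i = j
    · subst hi
      have : ¬ i = k := fun h => hk h.symm
      simp only [this, if_true, if_false]
      split_ifs <;> simp
    · simp [hi]

theorem flip_mul_list {n : ℕ} (j : Fin n) (l : List (Fin n)) :
    flipU j * (l.map fermion).prod = (-1 : ℂ) ^ (l.count j) • ((l.map fermion).prod * flipU j) := by
  induction l with
  | nil => simp
  | cons k l ih =>
    rw [List.map_cons, List.prod_cons, ← mul_assoc, flip_mul_fermion, smul_mul_assoc, mul_assoc,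
      ih, mul_smul_comm, smul_smul, mul_assoc, List.count_cons]
    congr 1
    split_ifs <;> simp_all [pow_succ]

theorem list_star_mul {n : ℕ} (l : List (Fin n)) :
    star (l.map fermion).prod * (l.map fermion).prod = 1 := by
  induction l with
  | nil => simp
  | cons k l ih =>
    rw [List.map_cons, List.prod_cons, star_mul, star_fermion, mul_assoc, ← mul_assoc (fermion k),
      fermion_mul_self, one_mul, ih]

theorem flip_mul_fermionProd {n : ℕ} (j : Fin n) (A : Finset (Fin n)) :
    flipU j * fermionProd A = (if j ∈ A then (-1 : ℂ) else 1) • (fermionProd A * flipU j) := by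
  rw [fermionProd, flip_mul_list]
  congr 1
  split_ifs with h
  · rw [List.count_eq_one_of_mem (Finset.sort_nodup _ _) (by simpa using h)]; simp
  · rw [List.count_eq_zero_of_not_mem (by simpa using h)]; simp

theorem star_flip {n : ℕ} (j : Fin n) : star (flipU j) = flipU j := by
  rw [flipU, star_tensor]
  congr 1
  funext i
  split_ifs <;> simp [star_U]

theorem flip_conj {n : ℕ} (j : Fin n) (A : Finset (Fin n)) :
    flipU j * fermionProd A * flipU j = (if j ∈ A then (-1 : ℂ) else 1) • fermionProd A := by
  rw [flip_mul_fermionProd, smul_mul_assoc, mul_assoc, flip_mul_self, mul_one]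

theorem trace_conj {n : ℕ} (j : Fin n) (X : Mat n) : (flipU j * X * flipU j).trace = X.trace := by
  rw [Matrix.trace_mul_comm, ← mul_assoc, flip_mul_self, one_mul]

theorem coeff_fermionProd {n : ℕ} (A B : Finset (Fin n)) :
    coeff A (fermionProd B) = if A = B then 1 else 0 := by
  split_ifs with h
  · subst h
    rw [coeff, fermionProd, list_star_mul, tau]
    simp [Matrix.trace_one]
  · obtain ⟨j, hj⟩ : ∃ j, ¬ (j ∈ A ↔ j ∈ B) := by
      by_contra hc
      push Not at hc
      exact h (Finset.ext hc)
    have e := trace_conj j (star (fermionProd A) * fermionProd B)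
    have e2 : flipU j * (star (fermionProd A) * fermionProd B) * flipU j =
        star (flipU j * fermionProd A * flipU j) * (flipU j * fermionProd B * flipU j) := by
      simp only [star_mul, star_flip, mul_assoc]
      rw [← mul_assoc (flipU j) (flipU j), flip_mul_self, one_mul]
    rw [e2, flip_conj, flip_conj] at e
    have : (star (fermionProd A) * fermionProd B).trace = 0 := by
      by_cases h1 : j ∈ A <;> by_cases h2 : j ∈ B <;>
        simp_all [neg_eq_iff_add_eq_zero, ← two_mul]
    rw [coeff, tau, this, zero_div]

/-- `D'_j` has the prescribed values on the basis `Q'_A`. -/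
theorem annihilate_fermionProd {n : ℕ} (j : Fin n) (A : Finset (Fin n)) :
    annihilate j (fermionProd A) = if j ∈ A then fermion j * fermionProd A else 0 := by
  rw [annihilate, Finset.sum_eq_single A]
  · simp [coeff_fermionProd]
  · intro B _ hB; simp [coeff_fermionProd, hB]
  · simp

/-- `N'^α` has the prescribed values on the basis `Q'_A`. -/
theorem numberPow_fermionProd {n : ℕ} (α : ℝ) (A : Finset (Fin n)) :
    numberPow α (fermionProd A) = (((A.card : ℝ) ^ α : ℝ) : ℂ) • fermionProd A := by
  rw [numberPow, Finset.sum_eq_single A]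
  · simp [coeff_fermionProd]
  · intro B _ hB; simp [coeff_fermionProd, hB]
  · simp

end CAR

end

/-! Both tails follow from Gaussian growth of even moments. If `tr (S*S)^p` is at most the `2p`-th
Gaussian moment times `v^p tr 1` for every `p`, then the series of `cosh` and Markov's inequality
give the tail `2 exp(-t²/(2v))` (`tail_of_moments`). Such moments come from a recursion `m (p+1) ≤
(2p+1) v m p`.

The engine of the recursion is an integration by parts, `sum_trace_star_mul_le`. Let `V_j` be
self-adjoint unitaries with `V_j X V_j = X - 2 d_j`, and let `d'_j` be odd under `V_j`. For
Hermitian `X`, `2 tr(d'_j X^(2p+1))` telescopes into a divided difference between `X` and `V_j X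
V_j`, which in the two eigenbases is a scalar inequality. Summing over `j` leaves only the row and
column square functions of `d` and `d'`. A Hermitian dilation extends this to arbitrary matrices.

For a centred `T`, let the noise operator multiply `Q'_A` by `c^|A|`. The mean value theorem in `c`
on `[0,1]` turns `tr (T*T)^(p+1)` into a sum of pairings of `Q'_j noise_c(D'_j T)` with `T(T*T)^p`.
Kadison–Schwarz and the parity trick keep the square functions below `v = ‖|∇_s T|‖²`. The resulting
exponent `t²/(2v)` is better than `4t²/(π²v)`, as `π² ≥ 8`.

For `N'^α`, adjoin fermions `P_j` anticommuting with the `Q'_j`. The element `Z = ∑ P_j D'_j T`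
obeys the recursion directly. Rotating each plane `(Q'_j, P_j)` by `θ` preserves traces, and the
part of the rotated `Z` in the first algebra multiplies the coefficient at `Q'_A` by `(d/dθ) cos^|A|
θ`. Integrating against `(-log cos θ)^(-α)` produces `Γ(1-α) N'^α T` up to sign, and Young's trace
inequality under the integral compares the moments of `N'^α T` with those of `K_α Z`. -/

namespace CAR

/-! ### Trace inequalities for Hermitian matrices -/

section TraceInequalities

variable {ι : Type*} [Fintype ι] [DecidableEq ι]

/-- The powers of a Hermitian matrix, diagonalized. -/
theorem exists_unitary_pow_eq {X : Matrix ι ι ℂ} (hX : X.IsHermitian) :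
    ∃ (U : Matrix ι ι ℂ) (x : ι → ℝ), star U * U = 1 ∧ U * star U = 1 ∧
      ∀ q : ℕ, X ^ q = U * Matrix.diagonal (fun i => ((x i ^ q : ℝ) : ℂ)) * star U := by
  refine ⟨hX.eigenvectorUnitary, hX.eigenvalues, Unitary.coe_star_mul_self _,
    Unitary.coe_mul_star_self _, fun q => ?_⟩
  conv_lhs => rw [hX.spectral_theorem, ← map_pow, Matrix.diagonal_pow,
    Unitary.conjStarAlgAut_apply]
  congr 3
  ext i
  simp

/-- Traces of alternating products of powers of two Hermitian matrices `X`, `Y` are averages of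
monomials in their eigenvalues. -/
theorem exists_trace_pow_mul_pow_eq {X Y : Matrix ι ι ℂ} (hX : X.IsHermitian)
    (hY : Y.IsHermitian) :
    ∃ (x y : ι → ℝ) (Φ : Matrix ι ι ℂ → ι → ι → ℂ), ∀ (q r : ℕ) (d d' : Matrix ι ι ℂ),
      (star d' * X ^ q * d * Y ^ r).trace.re =
        ∑ k, ∑ l, (star (Φ d' k l) * Φ d k l).re * (x k ^ q * y l ^ r) := by
  obtain ⟨U, x, hU, hU', hx⟩ := exists_unitary_pow_eq hX
  obtain ⟨W, y, hW, hW', hy⟩ := exists_unitary_pow_eq hY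
  refine ⟨x, y, fun d k l => (star U * d * W) k l, fun q r d d' => ?_⟩
  have key : (star d' * X ^ q * d * Y ^ r).trace = (star (star U * d' * W) *
      (Matrix.diagonal (fun i => ((x i ^ q : ℝ) : ℂ)) * (star U * d * W) *
        Matrix.diagonal (fun i => ((y i ^ r : ℝ) : ℂ)))).trace := by
    rw [hx, hy]
    simp only [star_mul, star_star]
    rw [← mul_assoc, ← mul_assoc, Matrix.trace_mul_comm]
    simp only [mul_assoc]
  rw [key, Matrix.trace, Complex.re_sum, Finset.sum_comm]
  refine Finset.sum_congr rfl fun l _ => ?_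
  rw [Matrix.diag_apply, Matrix.mul_apply, Complex.re_sum]
  refine Finset.sum_congr rfl fun k _ => ?_
  rw [Matrix.mul_diagonal, Matrix.diagonal_mul, Matrix.star_apply]
  rw [show ∀ a b : ℂ, ∀ s t : ℝ, a * ((s : ℂ) * b * (t : ℂ)) = (a * b) * ((s * t : ℝ) : ℂ) by
    intros; push_cast; ring, Complex.re_mul_ofReal]

/-- Pair `q` with `2p - q`: the powers of `|x|` and `|y|` are ordered alike, so `(|x|^q -
|y|^q)(|x|^(2p-q) - |y|^(2p-q)) ≥ 0`. Averaging over the `2p+1` values of `q` gives the constant. -/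
theorem sum_pow_mul_pow_le (x y : ℝ) (p : ℕ) :
    ∑ q ∈ Finset.range (2 * p + 1), |x| ^ q * |y| ^ (2 * p - q) ≤
      (2 * p + 1) / 2 * (x ^ (2 * p) + y ^ (2 * p)) := by
  have h2 : ∀ q ∈ Finset.range (2 * p + 1), |x| ^ q * |y| ^ (2 * p - q) +
      |x| ^ (2 * p - q) * |y| ^ q ≤ x ^ (2 * p) + y ^ (2 * p) := by
    intro q hq
    have hq' : q + (2 * p - q) = 2 * p := by simp at hq; omega
    have e1 : x ^ (2 * p) = |x| ^ q * |x| ^ (2 * p - q) := by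
      rw [← pow_add, hq', pow_mul, pow_mul, sq_abs]
    have e2 : y ^ (2 * p) = |y| ^ q * |y| ^ (2 * p - q) := by
      rw [← pow_add, hq', pow_mul, pow_mul, sq_abs]
    rw [e1, e2]
    rcases le_total |x| |y| with h | h
    · nlinarith [pow_le_pow_left₀ (abs_nonneg x) h q,
        pow_le_pow_left₀ (abs_nonneg x) h (2 * p - q)]
    · nlinarith [pow_le_pow_left₀ (abs_nonneg y) h q,
        pow_le_pow_left₀ (abs_nonneg y) h (2 * p - q)]
  have h3 := Finset.sum_le_sum h2
  rw [Finset.sum_add_distrib, Finset.sum_const, Finset.card_range, nsmul_eq_mul] at h3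
  have h4 : ∑ q ∈ Finset.range (2 * p + 1), |x| ^ (2 * p - q) * |y| ^ q =
      ∑ q ∈ Finset.range (2 * p + 1), |x| ^ q * |y| ^ (2 * p - q) := by
    rw [← Finset.sum_range_reflect]
    refine Finset.sum_congr rfl fun q hq => ?_
    simp only [Finset.mem_range] at hq
    congr 2; omega
  rw [h4] at h3
  push_cast at h3
  linarith

theorem re_star_mul_le (a b : ℂ) : |(star b * a).re| ≤
    ((star a * a).re + (star b * b).re) / 2 := by
  have e : ∀ z : ℂ, (star z * z).re = z.re ^ 2 + z.im ^ 2 := by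
    intro z; simp [Complex.mul_re]; ring
  have e2 : (star b * a).re = b.re * a.re + b.im * a.im := by simp [Complex.mul_re]
  rw [e, e, e2, abs_le]
  constructor <;> nlinarith [sq_nonneg (a.re - b.re), sq_nonneg (a.im - b.im),
    sq_nonneg (a.re + b.re), sq_nonneg (a.im + b.im)]

/-- A bound on the trace of a divided difference of an odd power. -/
theorem trace_sum_pow_mul_pow_le {X Y : Matrix ι ι ℂ} (hX : X.IsHermitian) (hY : Y.IsHermitian)
    (d d' : Matrix ι ι ℂ) (p : ℕ) :
    (∑ q ∈ Finset.range (2 * p + 1), star d' * X ^ q * d * Y ^ (2 * p - q)).trace.re ≤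
      (2 * p + 1) / 4 * ((star d * X ^ (2 * p) * d).trace.re +
        (star d * d * Y ^ (2 * p)).trace.re + (star d' * X ^ (2 * p) * d').trace.re +
        (star d' * d' * Y ^ (2 * p)).trace.re) := by
  obtain ⟨x, y, Φ, h⟩ := exists_trace_pow_mul_pow_eq hX hY
  -- With one exponent zero, the same weights express the traces on the right, so only a scalar
  -- inequality for each pair of eigenvalues remains.
  have h1 := h (2 * p) 0
  have h2 := h 0 (2 * p)
  simp only [pow_zero, mul_one] at h1 h2
  rw [Matrix.trace_sum, Complex.re_sum, Finset.sum_congr rfl fun q _ => h q (2 * p - q) d d',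
    h1, h1, h2, h2, Finset.sum_comm, ← Finset.sum_add_distrib, ← Finset.sum_add_distrib,
    ← Finset.sum_add_distrib, Finset.mul_sum]
  refine Finset.sum_le_sum fun k _ => ?_
  rw [Finset.sum_comm, ← Finset.sum_add_distrib, ← Finset.sum_add_distrib,
    ← Finset.sum_add_distrib, Finset.mul_sum]
  refine Finset.sum_le_sum fun l _ => ?_
  rw [← Finset.mul_sum]
  set a := Φ d k l
  set b := Φ d' k l
  have hs := sum_pow_mul_pow_le (x k) (y l) p
  have hab := re_star_mul_le a b
  have habs : |∑ q ∈ Finset.range (2 * p + 1), x k ^ q * y l ^ (2 * p - q)| ≤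
      ∑ q ∈ Finset.range (2 * p + 1), |x k| ^ q * |y l| ^ (2 * p - q) := by
    refine (Finset.abs_sum_le_sum_abs _ _).trans (le_of_eq ?_)
    simp [abs_mul, abs_pow]
  calc (star b * a).re * ∑ q ∈ Finset.range (2 * p + 1), x k ^ q * y l ^ (2 * p - q)
      ≤ |(star b * a).re| * |∑ q ∈ Finset.range (2 * p + 1), x k ^ q * y l ^ (2 * p - q)| := by
        rw [← abs_mul]; exact le_abs_self _
    _ ≤ ((star a * a).re + (star b * b).re) / 2 *
          ((2 * p + 1) / 2 * (x k ^ (2 * p) + y l ^ (2 * p))) :=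
        mul_le_mul hab (habs.trans hs) (abs_nonneg _) ((abs_nonneg _).trans hab)
    _ = _ := by ring

open scoped ComplexOrder in
theorem trace_mul_nonneg {A B : Matrix ι ι ℂ} (hA : 0 ≤ A) (hB : 0 ≤ B) :
    0 ≤ (A * B).trace.re := by
  obtain ⟨C, rfl⟩ := CStarAlgebra.nonneg_iff_eq_star_mul_self.mp hA
  rw [mul_assoc, Matrix.trace_mul_comm]
  have h : (0 : Matrix ι ι ℂ) ≤ C * B * star C := by
    simpa using star_right_conjugate_nonneg hB C
  exact (Complex.le_def.mp (Matrix.nonneg_iff_posSemidef.mp h).trace_nonneg).1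

theorem trace_mul_le {H M : Matrix ι ι ℂ} {v : ℝ} (hH : H ≤ (v : ℂ) • 1) (hM : 0 ≤ M) :
    (H * M).trace.re ≤ v * M.trace.re := by
  have := trace_mul_nonneg (sub_nonneg.mpr hH) hM
  rw [sub_mul, smul_mul_assoc, one_mul, Matrix.trace_sub, Matrix.trace_smul, smul_eq_mul,
    Complex.sub_re, Complex.re_ofReal_mul] at this
  linarith

theorem pow_even_nonneg {X : Matrix ι ι ℂ} (hX : star X = X) (p : ℕ) : 0 ≤ X ^ (2 * p) := by
  have : X ^ (2 * p) = star (X ^ p) * X ^ p := by rw [star_pow, hX, ← pow_add, two_mul]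
  rw [this]; exact star_mul_self_nonneg _

theorem pow_sub_pow_eq_sum (X Y : Matrix ι ι ℂ) (m : ℕ) :
    X ^ (m + 1) - Y ^ (m + 1) =
      ∑ q ∈ Finset.range (m + 1), X ^ q * (X - Y) * Y ^ (m - q) := by
  induction m with
  | zero => simp
  | succ m ih =>
    rw [Finset.sum_range_succ']
    have : ∑ q ∈ Finset.range (m + 1), X ^ (q + 1) * (X - Y) * Y ^ (m + 1 - (q + 1)) =
        X * ∑ q ∈ Finset.range (m + 1), X ^ q * (X - Y) * Y ^ (m - q) := by
      rw [Finset.mul_sum]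
      refine Finset.sum_congr rfl fun q _ => ?_
      rw [pow_succ', Nat.add_sub_add_right]
      simp only [mul_assoc]
    rw [this, ← ih]
    simp only [pow_zero, one_mul, Nat.sub_zero, mul_sub, sub_mul]
    rw [← pow_succ', ← pow_succ']
    abel

theorem conj_pow {V : Matrix ι ι ℂ} (hV : V * V = 1) (X : Matrix ι ι ℂ) (k : ℕ) :
    (V * X * V) ^ k = V * X ^ k * V := by
  induction k with
  | zero => simp [hV]
  | succ k ih =>
    rw [pow_succ, ih, pow_succ]
    calc V * X ^ k * V * (V * X * V) = V * X ^ k * (V * V) * X * V := by simp only [mul_assoc]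
      _ = _ := by rw [hV]; simp only [mul_one, mul_assoc]

/-- Integration by parts against an odd power of a Hermitian matrix. -/
theorem trace_mul_pow_le_of_flip {X V d d' : Matrix ι ι ℂ} (hX : star X = X) (hV : V * V = 1)
    (hVs : star V = V) (hd : star d = d) (hd' : star d' = d') (hXd : V * X * V = X - (2 : ℂ) • d)
    (hVd : V * d' * V = -d') (p : ℕ) :
    (d' * X ^ (2 * p + 1)).trace.re ≤
      (2 * p + 1) / 2 * ((d * d * X ^ (2 * p)).trace.re + (d' * d' * X ^ (2 * p)).trace.re) := by
  -- Conjugating twice by `V` returns `X`, which forces `d` to be odd as well.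
  have hVd0 : V * d * V = -d := by
    have h1 : V * (V * X * V) * V = X := by
      calc V * (V * X * V) * V = (V * V) * X * (V * V) := by simp only [mul_assoc]
        _ = X := by simp [hV]
    rw [hXd, mul_sub, sub_mul, hXd, mul_smul_comm, smul_mul_assoc] at h1
    have h2 : (2 : ℂ) • (V * d * V) = (2 : ℂ) • (-d) := by
      rw [smul_neg, ← sub_eq_zero]
      rw [← sub_eq_zero] at h1
      rw [← neg_eq_zero, ← h1]; abel
    exact smul_right_injective _ (two_ne_zero) h2
  set Y := V * X * V with hYdef
  have hY : star Y = Y := by rw [hYdef]; simp [hX, hVs, mul_assoc]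
  have cyc : ∀ a : Matrix ι ι ℂ, ∀ k, (a * Y ^ k).trace = (V * a * V * X ^ k).trace := by
    intro a k
    rw [hYdef, conj_pow hV, ← mul_assoc, Matrix.trace_mul_comm]
    simp only [mul_assoc]
  have sqc : ∀ e : Matrix ι ι ℂ, V * e * V = -e → V * (e * e) * V = e * e := by
    intro e he
    calc V * (e * e) * V = V * e * (V * V) * e * V := by rw [hV]; simp only [mul_one, mul_assoc]
      _ = (V * e * V) * (V * e * V) := by simp only [mul_assoc]
      _ = e * e := by rw [he, neg_mul_neg]
  have key := trace_sum_pow_mul_pow_le hX hY d d' p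
  have hsum : (∑ q ∈ Finset.range (2 * p + 1), star d' * X ^ q * d * Y ^ (2 * p - q)).trace =
      (d' * X ^ (2 * p + 1)).trace := by
    -- Since `X - Y = 2d`, the sum telescopes. Oddness of `d'` then gives `tr(d' Y^(2p+1)) = -tr(d'
    -- X^(2p+1))`, so the factor 2 cancels.
    have h1 : (2 : ℂ) • ∑ q ∈ Finset.range (2 * p + 1), star d' * X ^ q * d * Y ^ (2 * p - q) =
        d' * (X ^ (2 * p + 1) - Y ^ (2 * p + 1)) := by
      rw [pow_sub_pow_eq_sum, hXd, sub_sub_cancel, Finset.mul_sum, Finset.smul_sum]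
      refine Finset.sum_congr rfl fun q _ => ?_
      rw [hd']
      simp only [mul_smul_comm, smul_mul_assoc, mul_assoc]
    have h2 := congrArg Matrix.trace h1
    rw [mul_sub, Matrix.trace_sub, cyc, hVd, Matrix.trace_smul, neg_mul, Matrix.trace_neg,
      smul_eq_mul] at h2
    linear_combination h2 / 2
  rw [hsum] at key
  have r1 : ∀ e : Matrix ι ι ℂ, star e = e →
      (star e * X ^ (2 * p) * e).trace = (e * e * X ^ (2 * p)).trace := by
    intro e he
    rw [Matrix.trace_mul_comm, he, mul_assoc]
  rw [r1 d hd, r1 d' hd', hd, hd', cyc, cyc, sqc d hVd0, sqc d' hVd] at key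
  linarith

/-- The moment recursion, for a Hermitian matrix. -/
theorem sum_trace_mul_pow_le {κ : Type*} [Fintype κ] {X : Matrix ι ι ℂ} {V d d' : κ → Matrix ι ι ℂ}
    {v : ℝ} (hX : star X = X) (hV : ∀ j, V j * V j = 1)
    (hVs : ∀ j, star (V j) = V j) (hd : ∀ j, star (d j) = d j) (hd' : ∀ j, star (d' j) = d' j)
    (hXd : ∀ j, V j * X * V j = X - (2 : ℂ) • d j) (hVd : ∀ j, V j * d' j * V j = -d' j)
    (hv : ∑ j, d j * d j ≤ (v : ℂ) • 1) (hv' : ∑ j, d' j * d' j ≤ (v : ℂ) • 1) (p : ℕ) :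
    ∑ j, (d' j * X ^ (2 * p + 1)).trace.re ≤ (2 * p + 1) * v * (X ^ (2 * p)).trace.re := by
  have h1 := Finset.sum_le_sum fun j (_ : j ∈ Finset.univ) =>
    trace_mul_pow_le_of_flip hX (hV j) (hVs j) (hd j) (hd' j) (hXd j) (hVd j) p
  refine h1.trans ?_
  have a1 := trace_mul_le hv (pow_even_nonneg hX p)
  have a2 := trace_mul_le hv' (pow_even_nonneg hX p)
  rw [Finset.sum_mul, Matrix.trace_sum, Complex.re_sum] at a1 a2
  rw [← Finset.mul_sum, Finset.sum_add_distrib]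
  have : (0 : ℝ) ≤ (2 * p + 1) / 2 := by positivity
  nlinarith

end TraceInequalities

/-! ### Hermitian dilation and Young's inequality for traces -/

theorem star_fromBlocks {ι : Type*} (A B C D : Matrix ι ι ℂ) :
    star (Matrix.fromBlocks A B C D) = Matrix.fromBlocks (star A) (star C) (star B) (star D) :=
  Matrix.fromBlocks_conjTranspose A B C D

theorem trace_fromBlocks {ι : Type*} [Fintype ι] (A B C D : Matrix ι ι ℂ) :
    (Matrix.fromBlocks A B C D).trace = A.trace + D.trace := by
  simp [Matrix.trace, Fintype.sum_sum_type]

/-- The Hermitian dilation of a square matrix. -/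
def dilation {ι : Type*} (T : Matrix ι ι ℂ) : Matrix (ι ⊕ ι) (ι ⊕ ι) ℂ := Matrix.fromBlocks 0 T (star T) 0

theorem star_dilation {ι : Type*} (T : Matrix ι ι ℂ) : star (dilation T) = dilation T := by
  simp [dilation, star_fromBlocks]

section Dilation

variable {ι : Type*} [Fintype ι] [DecidableEq ι]

theorem dilation_mul_dilation (S T : Matrix ι ι ℂ) :
    dilation S * dilation T = Matrix.fromBlocks (S * star T) 0 0 (star S * T) := by
  simp [dilation, Matrix.fromBlocks_multiply]

theorem dilation_pow_even (T : Matrix ι ι ℂ) (p : ℕ) :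
    dilation T ^ (2 * p) = Matrix.fromBlocks ((T * star T) ^ p) 0 0 ((star T * T) ^ p) := by
  rw [pow_mul, pow_two, dilation_mul_dilation, Matrix.fromBlocks_diagonal_pow]

theorem mul_star_mul_pow (T : Matrix ι ι ℂ) (p : ℕ) :
    (T * star T) ^ p * T = T * (star T * T) ^ p := by
  induction p with
  | zero => simp
  | succ p ih => rw [pow_succ', pow_succ', mul_assoc, ih]; simp only [mul_assoc]

theorem dilation_pow_odd (T : Matrix ι ι ℂ) (p : ℕ) :
    dilation T ^ (2 * p + 1) = dilation (T * (star T * T) ^ p) := by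
  rw [pow_succ, dilation_pow_even]
  simp [dilation, Matrix.fromBlocks_multiply, mul_star_mul_pow]

theorem trace_star_mul_self_pow (T : Matrix ι ι ℂ) (p : ℕ) :
    ((T * star T) ^ p).trace = ((star T * T) ^ p).trace := by
  cases p with
  | zero => simp
  | succ p => rw [pow_succ, ← mul_assoc, Matrix.trace_mul_comm, mul_star_mul_pow, pow_succ',
      mul_assoc]

theorem trace_dilation_pow (T : Matrix ι ι ℂ) (p : ℕ) :
    (dilation T ^ (2 * p)).trace.re = 2 * ((star T * T) ^ p).trace.re := by
  rw [dilation_pow_even, trace_fromBlocks, trace_star_mul_self_pow, Complex.add_re]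
  ring

theorem trace_dilation_mul_pow (S T : Matrix ι ι ℂ) (p : ℕ) :
    (dilation S * dilation T ^ (2 * p + 1)).trace.re =
      2 * (star S * (T * (star T * T) ^ p)).trace.re := by
  rw [dilation_pow_odd, dilation_mul_dilation, trace_fromBlocks, Complex.add_re]
  have : (S * star (T * (star T * T) ^ p)).trace =
      star (star S * (T * (star T * T) ^ p)).trace := by
    rw [← Matrix.trace_conjTranspose, ← Matrix.star_eq_conjTranspose,
      star_mul (star S), star_star, Matrix.trace_mul_comm]
  rw [this, Complex.star_def, Complex.conj_re]
  ring

theorem fromBlocks_diagonal_nonneg {A D : Matrix ι ι ℂ} (hA : 0 ≤ A) (hD : 0 ≤ D) :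
    0 ≤ Matrix.fromBlocks A 0 0 D := by
  obtain ⟨B, rfl⟩ := CStarAlgebra.nonneg_iff_eq_star_mul_self.mp hA
  obtain ⟨C, rfl⟩ := CStarAlgebra.nonneg_iff_eq_star_mul_self.mp hD
  have : Matrix.fromBlocks (star B * B) 0 0 (star C * C) =
      star (Matrix.fromBlocks B 0 0 C) * Matrix.fromBlocks B 0 0 C := by
    simp [star_fromBlocks, Matrix.fromBlocks_multiply]
  rw [this]
  exact star_mul_self_nonneg _

/-- The square of a dilation is block diagonal with blocks `d d*` and `d* d`. This is where a bound
on both square functions, hence the symmetrized gradient, is required. -/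
theorem sum_dilation_sq_le {κ : Type*} [Fintype κ] {d : κ → Matrix ι ι ℂ} {v : ℝ}
    (h : ∑ j, d j * star (d j) ≤ (v : ℂ) • 1) (h' : ∑ j, star (d j) * d j ≤ (v : ℂ) • 1) :
    ∑ j, dilation (d j) * dilation (d j) ≤ (v : ℂ) • 1 := by
  rw [← sub_nonneg] at h h' ⊢
  convert fromBlocks_diagonal_nonneg h h' using 1
  simp only [dilation_mul_dilation]
  ext (i | i) (j | j) <;>
    simp [Matrix.sum_apply, Matrix.one_apply]

/-- The moment recursion. -/
theorem sum_trace_star_mul_le {κ : Type*} [Fintype κ] {T : Matrix ι ι ℂ}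
    {V d d' : κ → Matrix ι ι ℂ} {v : ℝ} (hV : ∀ j, V j * V j = 1) (hVs : ∀ j, star (V j) = V j)
    (hTd : ∀ j, V j * T * V j = T - (2 : ℂ) • d j) (hVd : ∀ j, V j * d' j * V j = -d' j)
    (h₁ : ∑ j, d j * star (d j) ≤ (v : ℂ) • 1) (h₂ : ∑ j, star (d j) * d j ≤ (v : ℂ) • 1)
    (h₃ : ∑ j, d' j * star (d' j) ≤ (v : ℂ) • 1) (h₄ : ∑ j, star (d' j) * d' j ≤ (v : ℂ) • 1)
    (p : ℕ) :
    ∑ j, (star (d' j) * (T * (star T * T) ^ p)).trace.re ≤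
      (2 * p + 1) * v * ((star T * T) ^ p).trace.re := by
  have conjd : ∀ j, ∀ S : Matrix ι ι ℂ, Matrix.fromBlocks (V j) 0 0 (V j) * dilation S *
      Matrix.fromBlocks (V j) 0 0 (V j) = dilation (V j * S * V j) := by
    intro j S
    simp [dilation, Matrix.fromBlocks_multiply, hVs, mul_assoc]
  have key := sum_trace_mul_pow_le (X := dilation T) (V := fun j => Matrix.fromBlocks (V j) 0 0 (V j))
    (d := fun j => dilation (d j)) (d' := fun j => dilation (d' j)) (star_dilation T)
    (fun j => by simp [Matrix.fromBlocks_multiply, hV])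
    (fun j => by simp [star_fromBlocks, hVs])
    (fun j => star_dilation _) (fun j => star_dilation _)
    (fun j => by
      rw [conjd, hTd]
      ext (i | i) (k | k) <;> simp [dilation])
    (fun j => by
      rw [conjd, hVd]
      ext (i | i) (k | k) <;> simp [dilation])
    (sum_dilation_sq_le h₁ h₂) (sum_dilation_sq_le h₃ h₄) p
  simp only [trace_dilation_mul_pow, trace_dilation_pow] at key
  rw [← Finset.mul_sum] at key
  linarith

theorem mul_pow_le_of_young (x y : ℝ) (p : ℕ) :
    x * y ^ (2 * p + 1) ≤
      (x ^ (2 * (p + 1)) + (2 * p + 1) * y ^ (2 * (p + 1))) / (2 * p + 2) := by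
  have habs : x * y ^ (2 * p + 1) ≤ |x| * |y| ^ (2 * p + 1) := by
    rw [← abs_pow, ← abs_mul]; exact le_abs_self _
  have ex : ∀ z : ℝ, z ^ (2 * (p + 1)) = |z| ^ (2 * (p + 1)) := by
    intro z; rw [pow_mul, pow_mul, sq_abs]
  refine habs.trans ?_
  rw [ex x, ex y]
  generalize |x| = a, abs_nonneg x = ha
  have hb := abs_nonneg y
  generalize |y| = b at hb
  have hpos : (0 : ℝ) < 2 * p + 2 := by positivity
  rcases hb.eq_or_lt with rfl | hb
  · have : 0 ≤ a ^ (2 * (p + 1)) := by rw [pow_mul]; positivity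
    have h0 : (0 : ℝ) ^ (2 * (p + 1)) = 0 := by simp
    rw [h0]
    simp only [ne_eq, Nat.add_eq_zero_iff, mul_eq_zero, OfNat.ofNat_ne_zero, one_ne_zero, and_false,
      not_false_eq_true, zero_pow, mul_zero, add_zero]
    positivity
  · rw [le_div_iff₀ hpos]
    -- Young's inequality with exponents `2p+2` and `(2p+2)/(2p+1)` is Bernoulli's inequality for
    -- the ratio `a/b`.
    have hB := one_add_mul_le_pow (a := a / b - 1)
      (by have : 0 ≤ a / b := div_nonneg (by assumption) hb.le
          linarith) (2 * (p + 1))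
    have hbp : 0 < b ^ (2 * (p + 1)) := by positivity
    have h2 := mul_le_mul_of_nonneg_right hB hbp.le
    rw [add_sub_cancel, div_pow, div_mul_cancel₀ _ hbp.ne'] at h2
    have e : a / b * b ^ (2 * (p + 1)) = a * b ^ (2 * p + 1) := by
      rw [show 2 * (p + 1) = (2 * p + 1) + 1 by ring, pow_succ]; field_simp
    push_cast at h2
    nlinarith [h2, e]

/-- Young's inequality for traces. -/
theorem trace_star_mul_le_young (S T : Matrix ι ι ℂ) (p : ℕ) :
    (star S * (T * (star T * T) ^ p)).trace.re ≤
      (((star S * S) ^ (p + 1)).trace.re + (2 * p + 1) * ((star T * T) ^ (p + 1)).trace.re) /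
        (2 * p + 2) := by
  obtain ⟨x, y, Φ, h⟩ := exists_trace_pow_mul_pow_eq (X := dilation S) (Y := dilation T)
    (star_dilation S) (star_dilation T)
  -- With `d = d' = 1` the weights are squared moduli of overlaps of eigenvectors, hence
  -- nonnegative, and the scalar inequality can be averaged.
  have h1 := h 1 (2 * p + 1) 1 1
  have h2 := h (2 * (p + 1)) 0 1 1
  have h3 := h 0 (2 * (p + 1)) 1 1
  simp only [star_one, one_mul, mul_one, pow_zero, pow_one, trace_dilation_mul_pow,
    trace_dilation_pow] at h1 h2 h3
  have h4 : ∑ k, ∑ l, (star (Φ 1 k l) * Φ 1 k l).re * (x k * y l ^ (2 * p + 1)) ≤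
      ((∑ k, ∑ l, (star (Φ 1 k l) * Φ 1 k l).re * x k ^ (2 * (p + 1))) + (2 * p + 1) *
        ∑ k, ∑ l, (star (Φ 1 k l) * Φ 1 k l).re * y l ^ (2 * (p + 1))) / (2 * p + 2) := by
    simp only [Finset.mul_sum]
    rw [← Finset.sum_add_distrib, Finset.sum_div]
    refine Finset.sum_le_sum fun k _ => ?_
    rw [← Finset.sum_add_distrib, Finset.sum_div]
    refine Finset.sum_le_sum fun l _ => ?_
    have h0 : 0 ≤ (star (Φ 1 k l) * Φ 1 k l).re := by
      simp only [Complex.star_def, Complex.mul_re, Complex.conj_re, Complex.conj_im]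
      nlinarith [sq_nonneg (Φ 1 k l).re, sq_nonneg (Φ 1 k l).im]
    refine (mul_le_mul_of_nonneg_left (mul_pow_le_of_young (x k) (y l) p) h0).trans (le_of_eq ?_)
    ring
  rw [← h1, ← h2, ← h3] at h4
  have : (2 * ((star S * S) ^ (p + 1)).trace.re +
      (2 * p + 1) * (2 * ((star T * T) ^ (p + 1)).trace.re)) / (2 * (p : ℝ) + 2) =
    2 * ((((star S * S) ^ (p + 1)).trace.re + (2 * p + 1) * ((star T * T) ^ (p + 1)).trace.re) /
        (2 * p + 2)) := by ring
  linarith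

end Dilation

/-! ### Gaussian moments and tail estimates -/

/-- The moment of order `2p` of a standard Gaussian variable. -/
noncomputable def gaussianMoment (p : ℕ) : ℝ := (2 * p).factorial / (2 ^ p * p.factorial)

theorem gaussianMoment_zero : gaussianMoment 0 = 1 := by simp [gaussianMoment]

theorem gaussianMoment_succ (p : ℕ) :
    gaussianMoment (p + 1) = (2 * p + 1) * gaussianMoment p := by
  rw [gaussianMoment, gaussianMoment, show 2 * (p + 1) = 2 * p + 1 + 1 by ring,
    Nat.factorial_succ, Nat.factorial_succ, Nat.factorial_succ, pow_succ]
  have : (p.factorial : ℝ) ≠ 0 := by positivity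
  push_cast
  field_simp
  ring

theorem le_gaussianMoment_of_recursion {m : ℕ → ℝ} {v : ℝ} (hv : 0 ≤ v)
    (h : ∀ p, m (p + 1) ≤ (2 * p + 1) * v * m p) (p : ℕ) :
    m p ≤ gaussianMoment p * v ^ p * m 0 := by
  induction p with
  | zero => simp [gaussianMoment_zero]
  | succ p ih =>
    refine (h p).trans ((mul_le_mul_of_nonneg_left ih (by positivity)).trans (le_of_eq ?_))
    rw [gaussianMoment_succ]
    ring

theorem trace_cfc {ι : Type*} [Fintype ι] [DecidableEq ι] {H : Matrix ι ι ℂ} (hH : H.IsHermitian)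
    (f : ℝ → ℝ) : (cfc f H).trace = ((∑ i, f (hH.eigenvalues i) : ℝ) : ℂ) := by
  rw [hH.cfc_eq, Matrix.IsHermitian.cfc, Unitary.conjStarAlgAut_apply, Matrix.trace_mul_cycle,
    Unitary.coe_star_mul_self, one_mul, Matrix.trace_diagonal]
  simp

/-- Tail estimate for a finite family of real numbers with subgaussian moments. -/
theorem sum_indicator_le_of_moments {ι : Type*} [Fintype ι] {h : ι → ℝ} {v M t : ℝ} (hv : 0 < v)
    (ht : 0 ≤ t) (hM : ∀ p, ∑ i, h i ^ (2 * p) ≤ gaussianMoment p * v ^ p * M) :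
    ∑ i, (Set.Ici t).indicator (fun _ => (1 : ℝ)) (h i) ≤ 2 * M * Real.exp (-(t ^ 2 / (2 * v))) := by
  -- The minimizer of `l²v/2 - lt`.
  set l : ℝ := t / v
  have hl : 0 ≤ l := by positivity
  have hcosh : HasSum (fun p : ℕ => ∑ i, (l * h i) ^ (2 * p) / (2 * p).factorial)
      (∑ i, Real.cosh (l * h i)) := hasSum_sum fun i _ => Real.hasSum_cosh (l * h i)
  have hexp : HasSum (fun p : ℕ => (l ^ 2 * v / 2) ^ p / p.factorial * M)
      (Real.exp (l ^ 2 * v / 2) * M) := by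
    have := NormedSpace.expSeries_div_hasSum_exp (l ^ 2 * v / 2)
    rw [← Real.exp_eq_exp_ℝ] at this
    exact this.mul_right M
  -- Compare the series termwise: the Gaussian moment divided by `(2p)!` is `1/(2^p p!)`.
  have h1 : ∑ i, Real.cosh (l * h i) ≤ Real.exp (l ^ 2 * v / 2) * M := by
    refine hasSum_le (fun p => ?_) hcosh hexp
    have e : ∑ i, (l * h i) ^ (2 * p) / (2 * p).factorial =
        l ^ (2 * p) / (2 * p).factorial * ∑ i, h i ^ (2 * p) := by
      rw [Finset.mul_sum]
      exact Finset.sum_congr rfl fun i _ => by ring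
    rw [e]
    refine (mul_le_mul_of_nonneg_left (hM p) (by positivity)).trans (le_of_eq ?_)
    rw [gaussianMoment, pow_mul, div_pow (l ^ 2 * v), mul_pow (l ^ 2)]
    have : ((2 * p).factorial : ℝ) ≠ 0 := by positivity
    field_simp
  -- Markov's inequality for `cosh`; dropping one of the two exponentials costs the factor 2 of the
  -- final bound.
  have h2 : Real.exp (l * t) / 2 * ∑ i, (Set.Ici t).indicator (fun _ => (1 : ℝ)) (h i) ≤
      ∑ i, Real.cosh (l * h i) := by
    rw [Finset.mul_sum]
    refine Finset.sum_le_sum fun i _ => ?_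
    by_cases hi : t ≤ h i
    · rw [Set.indicator_of_mem (by exact hi), mul_one, Real.cosh_eq]
      have := Real.exp_le_exp.mpr (mul_le_mul_of_nonneg_left hi hl)
      have := Real.exp_pos (-(l * h i))
      linarith
    · rw [Set.indicator_of_notMem (by exact hi), mul_zero]
      exact (Real.cosh_pos _).le
  have h3 := h2.trans h1
  have e1 : l ^ 2 * v / 2 = t ^ 2 / (2 * v) := by simp only [l]; field_simp
  have e2 : l * t = t ^ 2 / (2 * v) + t ^ 2 / (2 * v) := by simp only [l]; field_simp; ring
  rw [e1, e2, Real.exp_add] at h3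
  rw [Real.exp_neg]
  have hE := Real.exp_pos (t ^ 2 / (2 * v))
  generalize Real.exp (t ^ 2 / (2 * v)) = E at h3 hE
  rw [← div_eq_mul_inv, le_div_iff₀ hE]
  nlinarith

theorem star_abs_eq {n : ℕ} (S : Mat n) : star (CFC.abs S) = CFC.abs S :=
  (CFC.abs_nonneg S).isSelfAdjoint

theorem sum_eigenvalues_abs_pow {n : ℕ} (S : Mat n)
    (hH : (CFC.abs S : Mat n).IsHermitian) (p : ℕ) :
    ∑ i, hH.eigenvalues i ^ (2 * p) = ((star S * S) ^ p).trace.re := by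
  have h1 : (star S * S) ^ p = cfc (fun x : ℝ => x ^ (2 * p)) (CFC.abs S) := by
    rw [cfc_pow_id (R := ℝ) (CFC.abs S) (2 * p) (ha := (CFC.abs_nonneg S).isSelfAdjoint), pow_mul, CFC.abs_sq]
  rw [h1, trace_cfc hH, Complex.ofReal_re]

theorem tau_specProj_abs_eq {n : ℕ} (S : Mat n) (hH : (CFC.abs S : Mat n).IsHermitian) (t : ℝ) :
    tau (specProj t (CFC.abs S)) =
      (((∑ i, (Set.Ici t).indicator (fun _ => (1 : ℝ)) (hH.eigenvalues i)) / 2 ^ n : ℝ) : ℂ) := by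
  rw [tau, specProj, trace_cfc hH]
  push_cast
  rfl

/-- Tail estimate for a matrix whose even Schatten norms grow like those of a Gaussian variable. -/
theorem tail_of_moments {n : ℕ} {S : Mat n} {v : ℝ} (hv : 0 ≤ v)
    (hS : ∀ p, ((star S * S) ^ p).trace.re ≤ gaussianMoment p * v ^ p * 2 ^ n)
    {t : ℝ} (ht : 0 ≤ t) :
    (tau (specProj t (CFC.abs S))).re ≤ 2 * Real.exp (-(t ^ 2 / (2 * v))) ∧
      (v = 0 → 0 < t → tau (specProj t (CFC.abs S)) = 0) := by
  have hH : (CFC.abs S : Mat n).IsHermitian := star_abs_eq S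
  rw [tau_specProj_abs_eq S hH, Complex.ofReal_re]
  have hM : ∀ p, ∑ i, hH.eigenvalues i ^ (2 * p) ≤ gaussianMoment p * v ^ p * 2 ^ n :=
    fun p => by rw [sum_eigenvalues_abs_pow]; exact hS p
  have h2n : (0 : ℝ) < 2 ^ n := by positivity
  constructor
  · rcases hv.eq_or_lt with rfl | hv
    -- When `v = 0` the quotient is `0` by convention, so the exponential is `1` and counting
    -- eigenvalues suffices.
    · rw [mul_zero, div_zero, neg_zero, Real.exp_zero, mul_one, div_le_iff₀ h2n]
      have h0 : ∑ i, (Set.Ici t).indicator (fun _ => (1 : ℝ)) (hH.eigenvalues i) ≤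
          ∑ _i : Fin n → Fin 2, (1 : ℝ) :=
        Finset.sum_le_sum fun i _ => Set.indicator_le_self' (fun _ _ => zero_le_one) _
      simp only [Finset.sum_const, Finset.card_univ, Fintype.card_fun, Fintype.card_fin,
        nsmul_eq_mul, mul_one, Nat.cast_pow, Nat.cast_ofNat] at h0
      linarith
    · rw [div_le_iff₀ h2n]
      refine (sum_indicator_le_of_moments hv ht hM).trans (le_of_eq (by ring))
  · intro hv0 htpos
    -- A vanishing second moment forces every eigenvalue to be zero.
    have h1 := hM 1
    rw [hv0] at h1
    simp only [mul_one, pow_one, mul_zero, zero_mul] at h1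
    have h2 : ∀ i, hH.eigenvalues i = 0 := by
      intro i
      have := (Finset.sum_eq_zero_iff_of_nonneg (fun i _ => sq_nonneg (hH.eigenvalues i))).mp
        (le_antisymm h1 (Finset.sum_nonneg fun i _ => sq_nonneg _)) i (Finset.mem_univ i)
      exact pow_eq_zero_iff (two_ne_zero) |>.mp this
    have h3 : ∀ i, (Set.Ici t).indicator (fun _ => (1 : ℝ)) (hH.eigenvalues i) = 0 := by
      intro i
      rw [h2 i]
      exact Set.indicator_of_notMem (by simpa using htpos) _
    simp [h3]

/-! ### Anticommutation and the basis of the CAR algebra -/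

section Anticommuting

variable {κ R : Type*} [Ring R] [Algebra ℂ R] {e : κ → R}

/-- Permuting the factors of a product of anticommuting elements changes it by a sign. -/
theorem exists_sign_prod_of_perm (he : ∀ i j, i ≠ j → e i * e j = -(e j * e i)) {l l' : List κ}
    (h : l.Perm l') : ∃ s : ℂ, s * s = 1 ∧ (l.map e).prod = s • (l'.map e).prod := by
  induction h with
  | nil => exact ⟨1, by simp⟩
  | cons x _ ih =>
    obtain ⟨s, hs, h⟩ := ih
    exact ⟨s, hs, by simp [h]⟩
  | swap x y l =>
    by_cases hxy : x = y
    · exact ⟨1, by simp [hxy]⟩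
    · refine ⟨-1, by simp, ?_⟩
      simp only [List.map_cons, List.prod_cons, ← mul_assoc]
      rw [he y x (Ne.symm hxy)]
      simp
  | trans _ _ ih₁ ih₂ =>
    obtain ⟨s, hs, h⟩ := ih₁
    obtain ⟨s', hs', h'⟩ := ih₂
    exact ⟨s * s', by rw [mul_mul_mul_comm, hs, hs', mul_one], by rw [h, h', smul_smul]⟩

end Anticommuting

variable {n : ℕ}

theorem fermion_anticomm_of_lt {i j : Fin n} (h : i < j) :
    fermion i * fermion j = -(fermion j * fermion i) := by
  rw [fermion, fermion, tensor_mul, tensor_mul]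
  apply tensor_neg_at _ _ i
  · intro k hk
    rcases lt_trichotomy k i with h1 | h1 | h1
    · simp [h1, h1.trans h]
    · exact absurd h1 hk
    · simp [h1.not_gt, hk]
  · simp [h, U_mul_Q]

theorem fermion_anticomm (i j : Fin n) (h : i ≠ j) :
    fermion i * fermion j = -(fermion j * fermion i) := by
  rcases lt_or_gt_of_ne h with h | h
  · exact fermion_anticomm_of_lt h
  · rw [fermion_anticomm_of_lt h, neg_neg]

/-- The reordering sign is left unspecified: nothing beyond `s * s = 1` is ever used about it. -/
theorem exists_sign_fermionProd_insert {j : Fin n} {A : Finset (Fin n)} (hj : j ∉ A) :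
    ∃ s : ℂ, s * s = 1 ∧ fermionProd (insert j A) = s • (fermion j * fermionProd A) := by
  have hp : ((insert j A).sort (· ≤ ·)).Perm (j :: A.sort (· ≤ ·)) := by
    refine (List.perm_ext_iff_of_nodup (Finset.sort_nodup _ _) ?_).mpr (fun a => by simp)
    exact List.nodup_cons.mpr ⟨by simpa using hj, Finset.sort_nodup _ _⟩
  obtain ⟨s, hs, h⟩ := exists_sign_prod_of_perm fermion_anticomm hp
  exact ⟨s, hs, by rw [fermionProd, h, List.map_cons, List.prod_cons]; rfl⟩

theorem exists_sign_fermion_mul_of_mem {j : Fin n} {A : Finset (Fin n)} (hj : j ∈ A) :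
    ∃ s : ℂ, s * s = 1 ∧ fermion j * fermionProd A = s • fermionProd (A.erase j) := by
  obtain ⟨s, hs, h⟩ := exists_sign_fermionProd_insert (Finset.notMem_erase j A)
  rw [Finset.insert_erase hj] at h
  exact ⟨s, hs, by rw [h, mul_smul_comm, ← mul_assoc, fermion_mul_self, one_mul]⟩

theorem fermion_mul_mem_span (j : Fin n) (A : Finset (Fin n)) :
    fermion j * fermionProd A ∈ Submodule.span ℂ (Set.range (fermionProd (n := n))) := by
  by_cases hj : j ∈ A
  · obtain ⟨s, _, h⟩ := exists_sign_fermion_mul_of_mem hj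
    rw [h]
    exact Submodule.smul_mem _ _ (Submodule.subset_span ⟨_, rfl⟩)
  · obtain ⟨s, hs, h⟩ := exists_sign_fermionProd_insert hj
    have : fermion j * fermionProd A = s • fermionProd (insert j A) := by
      rw [h, smul_smul, hs, one_smul]
    rw [this]
    exact Submodule.smul_mem _ _ (Submodule.subset_span ⟨_, rfl⟩)

theorem fermionProd_empty : fermionProd (∅ : Finset (Fin n)) = 1 := by
  simp [fermionProd]

/-- The span is stable under left multiplication by fermions, and self-adjointness of the fermions
means that taking stars adds no generators. -/
theorem mem_span_of_mem_algebra {T : Mat n} (hT : T ∈ algebra n) :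
    T ∈ Submodule.span ℂ (Set.range (fermionProd (n := n))) := by
  have hmul : ∀ j : Fin n, ∀ S ∈ Submodule.span ℂ (Set.range (fermionProd (n := n))),
      fermion j * S ∈ Submodule.span ℂ (Set.range (fermionProd (n := n))) := by
    intro j S hS
    induction hS using Submodule.span_induction with
    | mem x hx => obtain ⟨A, rfl⟩ := hx; exact fermion_mul_mem_span j A
    | zero => simp
    | add x y _ _ hx hy => rw [mul_add]; exact Submodule.add_mem _ hx hy
    | smul a x _ hx => rw [mul_smul_comm]; exact Submodule.smul_mem _ _ hx
  have hstar : star (Set.range (fermion (n := n))) = Set.range (fermion (n := n)) := by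
    ext x
    simp only [Set.mem_star, Set.mem_range]
    constructor
    · rintro ⟨j, hj⟩
      exact ⟨j, by rw [← star_fermion j, hj, star_star]⟩
    · rintro ⟨j, rfl⟩
      exact ⟨j, (star_fermion j).symm⟩
  have h1 : T ∈ Algebra.adjoin ℂ (Set.range (fermion (n := n))) := by
    have h2 : T ∈ (StarAlgebra.adjoin ℂ (Set.range (fermion (n := n)))).toSubalgebra := hT
    rwa [StarAlgebra.adjoin_toSubalgebra, hstar, Set.union_self] at h2
  rw [← Subalgebra.mem_toSubmodule, Algebra.adjoin_eq_span] at h1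
  refine Submodule.span_le.mpr ?_ h1
  intro x hx
  induction hx using Submonoid.closure_induction_left with
  | one => exact fermionProd_empty (n := n) ▸ Submodule.subset_span ⟨∅, rfl⟩
  | mul_left x hx y _ ih => obtain ⟨j, rfl⟩ := hx; exact hmul j y ih

theorem coeff_add (A : Finset (Fin n)) (S T : Mat n) : coeff A (S + T) = coeff A S + coeff A T := by
  simp [coeff, tau, mul_add, add_div]

theorem coeff_smul (A : Finset (Fin n)) (c : ℂ) (T : Mat n) : coeff A (c • T) = c * coeff A T := by
  simp [coeff, tau, mul_div_assoc]

theorem coeff_zero (A : Finset (Fin n)) : coeff A (0 : Mat n) = 0 := by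
  simp [coeff, tau]

theorem sum_coeff_smul {T : Mat n} (hT : T ∈ algebra n) :
    ∑ A : Finset (Fin n), coeff A T • fermionProd A = T := by
  have hspan := mem_span_of_mem_algebra hT
  clear hT
  induction hspan using Submodule.span_induction with
  | mem x hx =>
    obtain ⟨B, rfl⟩ := hx
    rw [Finset.sum_eq_single B]
    · simp [coeff_fermionProd]
    · intro A _ hA; simp [coeff_fermionProd, hA]
    · simp
  | zero => simp [coeff_zero]
  | add x y _ _ hx hy => simp only [coeff_add, add_smul, Finset.sum_add_distrib, hx, hy]
  | smul a x _ hx => simp only [coeff_smul, mul_smul, ← Finset.smul_sum, hx]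

theorem coeff_empty (T : Mat n) : coeff ∅ T = tau T := by
  simp [coeff, fermionProd_empty]

/-- The part `∑_{A ∋ j} t_A Q'_A` of `T = ∑ t_A Q'_A`. -/
theorem fermion_mul_annihilate (j : Fin n) (T : Mat n) :
    fermion j * annihilate j T =
      ∑ A : Finset (Fin n), if j ∈ A then coeff A T • fermionProd A else 0 := by
  rw [annihilate, Finset.mul_sum]
  refine Finset.sum_congr rfl fun A _ => ?_
  split_ifs
  · rw [mul_smul_comm, ← mul_assoc, fermion_mul_self, one_mul]
  · simp

/-- The flip negates exactly the basis elements with `j ∈ A`, whose part in `T` is `Q'_j D'_j T`.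
This puts the annihilation operators into the form needed for the integration by parts. -/
theorem flip_conj_eq_sub {T : Mat n} (hT : T ∈ algebra n) (j : Fin n) :
    flipU j * T * flipU j = T - (2 : ℂ) • (fermion j * annihilate j T) := by
  have h : flipU j * (∑ A, coeff A T • fermionProd A) * flipU j =
      (∑ A, coeff A T • fermionProd A) -
        (2 : ℂ) • ∑ A : Finset (Fin n), if j ∈ A then coeff A T • fermionProd A else 0 := by
    rw [Finset.mul_sum, Finset.sum_mul, Finset.smul_sum, ← Finset.sum_sub_distrib]
    refine Finset.sum_congr rfl fun A _ => ?_
    rw [mul_smul_comm, smul_mul_assoc, flip_conj]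
    split_ifs
    · rw [neg_one_smul, smul_neg, two_smul]; abel
    · simp
  rwa [sum_coeff_smul hT, ← fermion_mul_annihilate] at h

/-! ### Parity conjugation -/

/-- The parity matrix `U ⊗ ⋯ ⊗ U`. -/
def parity (n : ℕ) : Mat n := tensor fun _ => pauliU

theorem parity_mul_self : parity n * parity n = 1 := by
  rw [parity, tensor_mul, ← tensor_one]
  simp [U_mul_U]

theorem star_parity : star (parity n) = parity n := by
  rw [parity, star_tensor]
  simp [star_U]

theorem parity_mul_fermion (j : Fin n) : parity n * fermion j = -(fermion j * parity n) := by
  rw [parity, fermion, tensor_mul, tensor_mul]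
  apply tensor_neg_at _ _ j
  · intro k hk
    simp only [hk, if_false]
    split_ifs <;> simp
  · simp [U_mul_Q]

/-- Each factor `Q'_i` with `i ≠ j` anticommutes both with the parity and with `Q'_j`, so both
conjugations produce the same sign. -/
theorem parity_conj_list {j : Fin n} {l : List (Fin n)} (hj : j ∉ l) :
    parity n * (l.map fermion).prod * parity n = fermion j * (l.map fermion).prod * fermion j := by
  induction l with
  | nil => simp [parity_mul_self, fermion_mul_self]
  | cons i l ih =>
    obtain ⟨h1, h2⟩ := not_or.mp (fun h => hj (List.mem_cons.mpr h))
    rw [List.map_cons, List.prod_cons, ← mul_assoc, parity_mul_fermion, ← mul_assoc (fermion j),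
      fermion_anticomm j i h1, neg_mul, neg_mul, neg_mul, neg_mul, mul_assoc (fermion i),
      mul_assoc (fermion i), ih h2, mul_assoc (fermion i) (fermion j), mul_assoc (fermion i)]

/-- `D'_j T` no longer contains `Q'_j`. The gain is that a conjugation depending on `j` becomes a
single one, which can be pulled out of a sum over `j`. -/
theorem parity_conj_annihilate (j : Fin n) (T : Mat n) :
    parity n * annihilate j T * parity n = fermion j * annihilate j T * fermion j := by
  rw [annihilate]
  simp only [Finset.mul_sum, Finset.sum_mul]
  refine Finset.sum_congr rfl fun A _ => ?_
  split_ifs with hj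
  · obtain ⟨s, _, h⟩ := exists_sign_fermion_mul_of_mem hj
    simp only [h, mul_smul_comm, smul_mul_assoc]
    rw [fermionProd, parity_conj_list (j := j) (by simp)]
  · simp

/-! ### The noise operator -/

/-- Averaging over the flips of the factors in a list, with bias `c`. -/
noncomputable def noise (c : ℝ) : List (Fin n) → (Mat n →ₗ[ℂ] Mat n)
  | [] => LinearMap.id
  | j :: l => ((((1 + c) / 2 : ℝ) : ℂ) • LinearMap.id +
      (((1 - c) / 2 : ℝ) : ℂ) • (LinearMap.mulLeft ℂ (flipU j) ∘ₗ LinearMap.mulRight ℂ (flipU j))) ∘ₗ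
        noise c l

theorem noise_cons (c : ℝ) (j : Fin n) (l : List (Fin n)) (S : Mat n) :
    noise c (j :: l) S = (((1 + c) / 2 : ℝ) : ℂ) • noise c l S +
      (((1 - c) / 2 : ℝ) : ℂ) • (flipU j * noise c l S * flipU j) := by
  simp [noise, mul_assoc]

theorem noise_fermionProd (c : ℝ) (l : List (Fin n)) (A : Finset (Fin n)) :
    noise c l (fermionProd A) =
      (((l.map fun j => if j ∈ A then c else 1).prod : ℝ) : ℂ) • fermionProd A := by
  induction l with
  | nil => simp [noise]
  | cons j l ih =>
    rw [noise_cons, ih, mul_smul_comm, smul_mul_assoc, flip_conj, List.map_cons, List.prod_cons]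
    simp only [smul_smul, ← add_smul]
    congr 1
    split_ifs <;> push_cast <;> ring

theorem noise_univ_fermionProd (c : ℝ) (A : Finset (Fin n)) :
    noise c Finset.univ.toList (fermionProd A) = ((c ^ A.card : ℝ) : ℂ) • fermionProd A := by
  rw [noise_fermionProd, Finset.prod_map_toList, Finset.prod_ite_mem]
  simp

theorem smul_nonneg_of_real {S : Mat n} (hS : 0 ≤ S) {r : ℝ} (hr : 0 ≤ r) : 0 ≤ (r : ℂ) • S := by
  obtain ⟨C, rfl⟩ := CStarAlgebra.nonneg_iff_eq_star_mul_self.mp hS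
  have : (r : ℂ) • (star C * C) = star (((Real.sqrt r : ℝ) : ℂ) • C) * (((Real.sqrt r : ℝ) : ℂ) • C) := by
    rw [star_smul, smul_mul_smul_comm, Complex.star_def, Complex.conj_ofReal, ← Complex.ofReal_mul,
      Real.mul_self_sqrt hr]
  rw [this]
  exact star_mul_self_nonneg _

theorem flip_conj_nonneg {S : Mat n} (hS : 0 ≤ S) (j : Fin n) : 0 ≤ flipU j * S * flipU j := by
  have := star_left_conjugate_nonneg hS (flipU j)
  rwa [star_flip] at this

theorem noise_nonneg {c : ℝ} (hc : |c| ≤ 1) (l : List (Fin n)) {S : Mat n} (hS : 0 ≤ S) :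
    0 ≤ noise c l S := by
  obtain ⟨h1, h2⟩ := abs_le.mp hc
  induction l with
  | nil => simpa [noise]
  | cons j l ih =>
    rw [noise_cons]
    exact add_nonneg (smul_nonneg_of_real ih (by linarith))
      (smul_nonneg_of_real (flip_conj_nonneg ih j) (by linarith))

theorem noise_one (c : ℝ) (l : List (Fin n)) : noise c l 1 = 1 := by
  induction l with
  | nil => simp [noise]
  | cons j l ih =>
    rw [noise_cons, ih, mul_one, flip_mul_self, ← add_smul, ← Complex.ofReal_add]
    convert one_smul ℂ (1 : Mat n) using 2
    push_cast; ring

theorem noise_star (c : ℝ) (l : List (Fin n)) (S : Mat n) :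
    noise c l (star S) = star (noise c l S) := by
  induction l with
  | nil => simp [noise]
  | cons j l ih => simp [noise_cons, ih, star_flip, mul_assoc]

/-- The Kadison–Schwarz inequality for `noise`. -/
theorem star_noise_mul_noise_le {c : ℝ} (hc : |c| ≤ 1) (l : List (Fin n)) (S : Mat n) :
    star (noise c l S) * noise c l S ≤ noise c l (star S * S) := by
  obtain ⟨h1, h2⟩ := abs_le.mp hc
  induction l with
  | nil => simp [noise]
  | cons j l ih =>
    rw [noise_cons, noise_cons]
    set a := noise c l S
    set b := noise c l (star S * S)
    set V := flipU j
    have hV : V * V = 1 := flip_mul_self j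
    have hVs : star V = V := star_flip j
    have hVV : ∀ x, V * (V * x) = x := fun x => by rw [← mul_assoc, hV, one_mul]
    have hab : 0 ≤ b - star a * a := sub_nonneg.mpr ih
    have k1 := smul_nonneg_of_real hab (r := (1 + c) / 2) (by linarith)
    have k2 := smul_nonneg_of_real (flip_conj_nonneg hab j) (r := (1 - c) / 2) (by linarith)
    -- The variance of the two-point average: the weighted mean of the squares minus the square of
    -- the mean is the product of the weights times `|a - V a V|²`.
    have k3 := smul_nonneg_of_real (star_mul_self_nonneg (a - V * a * V))
      (r := (1 + c) / 2 * ((1 - c) / 2)) (mul_nonneg (by linarith) (by linarith))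
    rw [← sub_nonneg]
    refine (add_nonneg (add_nonneg k1 k2) k3).trans (le_of_eq ?_)
    simp only [star_add, star_smul, star_sub, star_mul, hVs, Complex.star_def, Complex.conj_ofReal,
      mul_add, add_mul, mul_sub, sub_mul, smul_add, smul_sub, mul_smul_comm, smul_mul_assoc,
      smul_smul, mul_assoc, hVV, V]
    push_cast
    module

/-! ### Square function bounds -/

open scoped Matrix.Norms.L2Operator in
theorem le_normInf_smul_one {S : Mat n} (hS : star S = S) : S ≤ (normInf S : ℂ) • 1 := by
  have h : IsSelfAdjoint S := hS
  have h1 := h.le_algebraMap_norm_self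
  have h2 : ‖S‖ = normInf S := rfl
  rw [h2, Algebra.algebraMap_eq_smul_one] at h1
  exact h1

open scoped Matrix.Norms.L2Operator in
theorem normInf_star_mul_self (S : Mat n) : normInf (star S * S) = normInf S ^ 2 := by
  rw [sq]
  exact CStarRing.norm_star_mul_self (x := S)

theorem sum_annihilate_le (T : Mat n) :
    ∑ j, (annihilate j T * star (annihilate j T) + star (annihilate j T) * annihilate j T) ≤
      ((normInf (gradNorm T) ^ 2 : ℝ) : ℂ) • 1 := by
  set S : Mat n :=
    ∑ j, (annihilate j T * star (annihilate j T) + star (annihilate j T) * annihilate j T) with hSdef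
  have hS : 0 ≤ S := Finset.sum_nonneg fun j _ =>
    add_nonneg (mul_star_self_nonneg _) (star_mul_self_nonneg _)
  have hg : gradNorm T = CFC.sqrt S := by
    rw [gradNorm, hSdef]
    simp only [CFC.abs_sq, star_star]
  have hg2 : star (gradNorm T) * gradNorm T = S := by
    rw [hg, (CFC.sqrt_nonneg S).isSelfAdjoint.star_eq, CFC.sqrt_mul_sqrt_self S hS]
  rw [← normInf_star_mul_self, hg2]
  exact le_normInf_smul_one hS.isSelfAdjoint

theorem sum_annihilate_mul_star_le (T : Mat n) :
    ∑ j, annihilate j T * star (annihilate j T) ≤ ((normInf (gradNorm T) ^ 2 : ℝ) : ℂ) • 1 := by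
  refine le_trans (Finset.sum_le_sum fun j _ => ?_) (sum_annihilate_le T)
  exact le_add_of_nonneg_right (star_mul_self_nonneg _)

theorem sum_star_annihilate_mul_le (T : Mat n) :
    ∑ j, star (annihilate j T) * annihilate j T ≤ ((normInf (gradNorm T) ^ 2 : ℝ) : ℂ) • 1 := by
  refine le_trans (Finset.sum_le_sum fun j _ => ?_) (sum_annihilate_le T)
  exact le_add_of_nonneg_left (mul_star_self_nonneg _)

theorem parity_conj_le {S : Mat n} {v : ℝ} (hS : S ≤ (v : ℂ) • 1) :
    parity n * S * parity n ≤ (v : ℂ) • 1 := by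
  have h := star_left_conjugate_le_conjugate hS (parity n)
  rwa [star_parity, mul_smul_comm, mul_one, smul_mul_assoc, parity_mul_self] at h

/-- The square function of the odd parts `Q'_j D'_j T` on the left. -/
theorem sum_fermion_conj_le (T : Mat n) :
    ∑ j, fermion j * (annihilate j T * star (annihilate j T)) * fermion j ≤
      ((normInf (gradNorm T) ^ 2 : ℝ) : ℂ) • 1 := by
  have h : ∀ j : Fin n, fermion j * (annihilate j T * star (annihilate j T)) * fermion j =
      parity n * (annihilate j T * star (annihilate j T)) * parity n := by
    intro j
    have e : ∀ x a : Mat n, x * x = 1 → star x = x →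
        x * (a * star a) * x = (x * a * x) * star (x * a * x) := by
      intro x a h1 h2
      simp only [star_mul, h2, mul_assoc]
      rw [← mul_assoc x x, h1, one_mul]
    rw [e _ _ (fermion_mul_self j) (star_fermion j), e _ _ parity_mul_self star_parity,
      parity_conj_annihilate]
  rw [Finset.sum_congr rfl fun j _ => h j, ← Finset.sum_mul, ← Finset.mul_sum]
  exact parity_conj_le (sum_annihilate_mul_star_le T)

theorem noise_le {c : ℝ} (hc : |c| ≤ 1) (l : List (Fin n)) {S : Mat n} {v : ℝ}
    (hS : S ≤ (v : ℂ) • 1) : noise c l S ≤ (v : ℂ) • 1 := by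
  have h := noise_nonneg hc l (sub_nonneg.mpr hS)
  rwa [map_sub, map_smul, noise_one, sub_nonneg] at h

/-- Each flip commutes with `Q'_j` up to a sign, and the sign occurs twice in a conjugation. -/
theorem noise_fermion_conj (c : ℝ) (l : List (Fin n)) (j : Fin n) (S : Mat n) :
    noise c l (fermion j * S * fermion j) = fermion j * noise c l S * fermion j := by
  induction l with
  | nil => simp [noise]
  | cons i l ih =>
    have h : ∀ X : Mat n, flipU i * (fermion j * X * fermion j) * flipU i =
        fermion j * (flipU i * X * flipU i) * fermion j := by
      intro X
      have h1 := flip_mul_fermion i j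
      have h2 : fermion j * flipU i = (if j = i then (-1 : ℂ) else 1) • (flipU i * fermion j) := by
        rw [h1, smul_smul]; split_ifs <;> simp
      calc flipU i * (fermion j * X * fermion j) * flipU i
          = (flipU i * fermion j) * X * (fermion j * flipU i) := by simp only [mul_assoc]
        _ = ((if j = i then (-1 : ℂ) else 1) • (fermion j * flipU i)) * X *
              ((if j = i then (-1 : ℂ) else 1) • (flipU i * fermion j)) := by rw [← h1, ← h2]
        _ = fermion j * (flipU i * X * flipU i) * fermion j := by
          simp only [smul_mul_assoc, mul_smul_comm, smul_smul, mul_assoc]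
          split_ifs <;> simp
    rw [noise_cons, noise_cons, ih, h]
    simp only [mul_add, add_mul, mul_smul_comm, smul_mul_assoc]

/-- Annihilation lowers the degree by one before the noise acts, hence the exponent `|A| - 1`;
summing over `j ∈ A` will give the derivative of `c^|A|`. -/
theorem fermion_mul_noise_annihilate (c : ℝ) (j : Fin n) (T : Mat n) :
    fermion j * noise c Finset.univ.toList (annihilate j T) =
      ∑ A : Finset (Fin n),
        if j ∈ A then ((c ^ (A.card - 1) : ℝ) : ℂ) • coeff A T • fermionProd A else 0 := by
  rw [annihilate, map_sum, Finset.mul_sum]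
  refine Finset.sum_congr rfl fun A _ => ?_
  split_ifs with hj
  · obtain ⟨s, _, h⟩ := exists_sign_fermion_mul_of_mem hj
    have h1 : noise c Finset.univ.toList (fermion j * fermionProd A) =
        ((c ^ (A.card - 1) : ℝ) : ℂ) • (fermion j * fermionProd A) := by
      rw [h, map_smul, noise_univ_fermionProd, Finset.card_erase_of_mem hj, smul_comm]
    rw [map_smul, h1, mul_smul_comm, mul_smul_comm, ← mul_assoc, fermion_mul_self, one_mul,
      smul_comm]
  · simp

theorem sum_star_fermion_noise_mul_le {c : ℝ} (hc : |c| ≤ 1) (T : Mat n) :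
    ∑ j, star (fermion j * noise c Finset.univ.toList (annihilate j T)) *
      (fermion j * noise c Finset.univ.toList (annihilate j T)) ≤
        ((normInf (gradNorm T) ^ 2 : ℝ) : ℂ) • 1 := by
  have h := noise_le hc Finset.univ.toList (sum_star_annihilate_mul_le T)
  rw [map_sum] at h
  refine le_trans (Finset.sum_le_sum fun j _ => ?_) h
  rw [star_mul, star_fermion, mul_assoc, ← mul_assoc (fermion j), fermion_mul_self, one_mul]
  exact star_noise_mul_noise_le hc _ _

/-- In this order the outer fermions do not cancel. They are moved through the noise,
Kadison–Schwarz is applied to the adjoint, and the sum is controlled by the parity argument of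
`sum_fermion_conj_le`. -/
theorem sum_fermion_noise_mul_star_le {c : ℝ} (hc : |c| ≤ 1) (T : Mat n) :
    ∑ j, (fermion j * noise c Finset.univ.toList (annihilate j T)) *
      star (fermion j * noise c Finset.univ.toList (annihilate j T)) ≤
        ((normInf (gradNorm T) ^ 2 : ℝ) : ℂ) • 1 := by
  have h := noise_le hc Finset.univ.toList (sum_fermion_conj_le T)
  rw [map_sum] at h
  refine le_trans (Finset.sum_le_sum fun j _ => ?_) h
  rw [noise_fermion_conj, star_mul, star_fermion, ← mul_assoc, mul_assoc (fermion j)]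
  have h1 := star_noise_mul_noise_le hc Finset.univ.toList (star (annihilate j T))
  rw [noise_star, star_star] at h1
  have h2 := star_left_conjugate_le_conjugate h1 (fermion j)
  rwa [star_fermion, star_star] at h2

/-! ### Moments and tail of a centred element -/

/-- The moment recursion for a centred element of the CAR algebra. -/
theorem moment_succ_le {T : Mat n} (hT : T ∈ algebra n) (h0 : coeff ∅ T = 0) (p : ℕ) :
    ((star T * T) ^ (p + 1)).trace.re ≤
      (2 * p + 1) * normInf (gradNorm T) ^ 2 * ((star T * T) ^ p).trace.re := by
  set W := T * (star T * T) ^ p with hW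
  set b : Finset (Fin n) → ℝ := fun A => (star (coeff A T • fermionProd A) * W).trace.re with hb
  -- The pairing of the noisy `T` with `W`, interpolating between the mean at `c = 0` and the moment
  -- at `c = 1`. One intermediate point suffices, since the bounds are uniform in `c`.
  set g : ℝ → ℝ := fun c => ∑ A, c ^ A.card * b A with hg
  set g' : ℝ → ℝ := fun c => ∑ A, (A.card : ℝ) * c ^ (A.card - 1) * b A with hg'
  have hder : ∀ c, HasDerivAt g (g' c) c := fun c =>
    HasDerivAt.fun_sum fun A _ => (hasDerivAt_pow A.card c).mul_const (b A)
  obtain ⟨c, hc, hslope⟩ := exists_hasDerivAt_eq_slope g g' zero_lt_one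
    (fun c _ => (hder c).continuousAt.continuousWithinAt) (fun c _ => hder c)
  have hg1 : g 1 = ((star T * T) ^ (p + 1)).trace.re := by
    simp only [hg, hb, one_pow, one_mul]
    rw [← Complex.re_sum, ← Matrix.trace_sum, ← Finset.sum_mul, ← star_sum, sum_coeff_smul hT, hW,
      pow_succ', mul_assoc]
  have hg0 : g 0 = 0 := by
    simp only [hg]
    refine Finset.sum_eq_zero fun A _ => ?_
    -- As `0^0 = 1`, the empty set survives at `c = 0`; its term vanishes because `T` is centred.
    rcases Finset.eq_empty_or_nonempty A with rfl | hA
    · simp [hb, h0]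
    · simp [hA.card_pos.ne']
  rw [hg1, hg0, sub_zero, sub_zero, div_one] at hslope
  rw [← hslope]
  have hc1 : |c| ≤ 1 := abs_le.mpr ⟨by linarith [hc.1], hc.2.le⟩
  set d' : Fin n → Mat n := fun j => fermion j * noise c Finset.univ.toList (annihilate j T)
  have key := sum_trace_star_mul_le (T := T) (V := flipU)
    (d := fun j => fermion j * annihilate j T) (d' := d') (v := normInf (gradNorm T) ^ 2)
    flip_mul_self star_flip (flip_conj_eq_sub hT)
    (fun j => by
      simp only [d']
      rw [fermion_mul_noise_annihilate, Finset.mul_sum, Finset.sum_mul, ← Finset.sum_neg_distrib]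
      refine Finset.sum_congr rfl fun A _ => ?_
      split_ifs with hj
      · simp [flip_conj, hj]
      · simp)
    (by
      refine le_trans (le_of_eq (Finset.sum_congr rfl fun j _ => ?_)) (sum_fermion_conj_le T)
      simp only [star_mul, star_fermion, mul_assoc])
    (by
      refine le_trans (le_of_eq (Finset.sum_congr rfl fun j _ => ?_)) (sum_star_annihilate_mul_le T)
      rw [star_mul, star_fermion, mul_assoc, ← mul_assoc (fermion j), fermion_mul_self, one_mul])
    (sum_fermion_noise_mul_star_le hc1 T) (sum_star_fermion_noise_mul_le hc1 T) p
  refine le_trans (le_of_eq ?_) key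
  have e : ∀ j, (star (d' j) * W).trace.re =
      ∑ A : Finset (Fin n), if j ∈ A then c ^ (A.card - 1) * b A else 0 := by
    intro j
    simp only [d']
    rw [fermion_mul_noise_annihilate, star_sum, Finset.sum_mul, Matrix.trace_sum, Complex.re_sum]
    refine Finset.sum_congr rfl fun A _ => ?_
    split_ifs
    · rw [star_smul, smul_mul_assoc, Matrix.trace_smul, smul_eq_mul, Complex.star_def,
        Complex.conj_ofReal, Complex.re_ofReal_mul]
    · simp
  -- Each `A` is counted once for every `j ∈ A`, which supplies the factor `|A|` of `g'`.
  rw [Finset.sum_congr rfl fun j _ => e j, Finset.sum_comm]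
  refine Finset.sum_congr rfl fun A _ => ?_
  rw [Finset.sum_ite_mem, Finset.univ_inter, Finset.sum_const, nsmul_eq_mul, mul_assoc]

theorem trace_one_re : (1 : Mat n).trace.re = 2 ^ n := by
  rw [Matrix.trace_one]
  simp only [Fintype.card_fun, Fintype.card_fin]
  norm_cast

theorem moment_le {T : Mat n} (hT : T ∈ algebra n) (h0 : coeff ∅ T = 0) (p : ℕ) :
    ((star T * T) ^ p).trace.re ≤
      gaussianMoment p * (normInf (gradNorm T) ^ 2) ^ p * 2 ^ n := by
  have h := le_gaussianMoment_of_recursion (m := fun p => ((star T * T) ^ p).trace.re)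
    (sq_nonneg _) (moment_succ_le hT h0) p
  simpa only [pow_zero, trace_one_re] using h

theorem coeff_sub_tau (T : Mat n) (A : Finset (Fin n)) :
    coeff A (T - tau T • (1 : Mat n)) = if A = ∅ then 0 else coeff A T := by
  rw [sub_eq_add_neg, ← neg_smul, coeff_add, coeff_smul, ← fermionProd_empty, coeff_fermionProd]
  split_ifs with h
  · rw [h, coeff_empty]; ring
  · ring

theorem annihilate_sub_tau (T : Mat n) (j : Fin n) :
    annihilate j (T - tau T • (1 : Mat n)) = annihilate j T := by
  rw [annihilate, annihilate]
  refine Finset.sum_congr rfl fun A _ => ?_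
  split_ifs with hj
  · rw [coeff_sub_tau, if_neg (Finset.ne_empty_of_mem hj)]
  · rfl

theorem tail_sub_tau {T : Mat n} (hT : T ∈ algebra n) {t : ℝ} (ht : 0 ≤ t) :
    (tau (specProj t (CFC.abs (T - tau T • (1 : Mat n))))).re ≤
        2 * Real.exp (-(4 * t ^ 2 / (Real.pi ^ 2 * normInf (gradNorm T) ^ 2))) ∧
      (normInf (gradNorm T) = 0 → 0 < t →
        tau (specProj t (CFC.abs (T - tau T • (1 : Mat n)))) = 0) := by
  have hT' : T - tau T • (1 : Mat n) ∈ algebra n :=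
    sub_mem hT (SMulMemClass.smul_mem _ (one_mem _))
  have hgrad : gradNorm (T - tau T • (1 : Mat n)) = gradNorm T := by
    simp only [gradNorm, annihilate_sub_tau]
  have h := tail_of_moments (sq_nonneg (normInf (gradNorm T)))
    (hgrad ▸ moment_le hT' (by simp [coeff_sub_tau])) ht
  refine ⟨h.1.trans ?_, fun h0 => h.2 (by rw [h0]; simp)⟩
  refine mul_le_mul_of_nonneg_left (Real.exp_le_exp.mpr (neg_le_neg ?_)) zero_le_two
  rcases (sq_nonneg (normInf (gradNorm T))).eq_or_lt with hv | hv
  · rw [← hv]; simp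
  -- The moments give the rate `1/(2v)`, which dominates `4/(π²v)` as soon as `π² ≥ 8`.
  · have hpi : 8 ≤ Real.pi ^ 2 := by nlinarith [Real.pi_gt_three]
    rw [div_le_div_iff₀ (by positivity) (by positivity)]
    have : 0 ≤ t ^ 2 * normInf (gradNorm T) ^ 2 := by positivity
    nlinarith

/-! ### The doubled algebra and the gradient -/

/-- The algebra `𝓜_{2^n} ⊗ 𝓜_{2^n}`. -/
abbrev DoubleMat (n : ℕ) : Type :=
  Matrix ((Fin n → Fin 2) × (Fin n → Fin 2)) ((Fin n → Fin 2) × (Fin n → Fin 2)) ℂ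

open scoped Kronecker in
/-- The embedding `S ↦ S ⊗ 1`. -/
noncomputable def lift : Mat n →⋆ₐ[ℂ] DoubleMat n where
  toFun S := S ⊗ₖ (1 : Mat n)
  map_one' := Matrix.one_kronecker_one
  map_mul' S T := by rw [← Matrix.mul_kronecker_mul, one_mul]
  map_zero' := Matrix.zero_kronecker _
  map_add' S T := Matrix.add_kronecker _ _ _
  commutes' c := by
    rw [Algebra.algebraMap_eq_smul_one, Algebra.algebraMap_eq_smul_one, Matrix.smul_kronecker,
      Matrix.one_kronecker_one]
  map_star' S := by
    rw [Matrix.star_eq_conjTranspose, Matrix.star_eq_conjTranspose, Matrix.conjTranspose_kronecker,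
      Matrix.conjTranspose_one]

open scoped Kronecker in
theorem lift_eq (S : Mat n) : lift S = S ⊗ₖ (1 : Mat n) := rfl

open scoped Kronecker in
/-- A second family of fermions, anticommuting with the `lift (fermion j)`. -/
noncomputable def copy (j : Fin n) : DoubleMat n := parity n ⊗ₖ fermion j

open scoped Kronecker in
theorem copy_eq (j : Fin n) : copy j = parity n ⊗ₖ fermion j := rfl

open scoped Kronecker in
/-- The flip of the second family of fermions. -/
noncomputable def copyFlip (j : Fin n) : DoubleMat n := (1 : Mat n) ⊗ₖ flipU j

open scoped Kronecker in
theorem copyFlip_eq (j : Fin n) : copyFlip j = (1 : Mat n) ⊗ₖ flipU j := rfl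

theorem copy_mul_self (j : Fin n) : copy j * copy j = 1 := by
  rw [copy_eq, ← Matrix.mul_kronecker_mul, parity_mul_self, fermion_mul_self,
    Matrix.one_kronecker_one]

theorem star_copy (j : Fin n) : star (copy j) = copy j := by
  rw [copy_eq, Matrix.star_eq_conjTranspose, Matrix.conjTranspose_kronecker,
    ← Matrix.star_eq_conjTranspose, ← Matrix.star_eq_conjTranspose, star_parity, star_fermion]

theorem copy_anticomm {i j : Fin n} (h : i ≠ j) : copy i * copy j = -(copy j * copy i) := by
  rw [copy_eq, copy_eq, ← Matrix.mul_kronecker_mul, ← Matrix.mul_kronecker_mul,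
    fermion_anticomm i j h]
  ext a b; simp [Matrix.kroneckerMap_apply]

theorem copy_mul_lift_fermion (i j : Fin n) :
    copy i * lift (fermion j) = -(lift (fermion j) * copy i) := by
  rw [copy_eq, lift_eq, ← Matrix.mul_kronecker_mul, ← Matrix.mul_kronecker_mul, mul_one, one_mul,
    parity_mul_fermion]
  ext a b; simp [Matrix.kroneckerMap_apply]

theorem copy_conj_lift (j : Fin n) (S : Mat n) :
    copy j * lift S * copy j = lift (parity n * S * parity n) := by
  rw [copy_eq, lift_eq, lift_eq, ← Matrix.mul_kronecker_mul, ← Matrix.mul_kronecker_mul, mul_one,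
    fermion_mul_self]

theorem copyFlip_mul_self (j : Fin n) : copyFlip j * copyFlip j = 1 := by
  rw [copyFlip_eq, ← Matrix.mul_kronecker_mul, one_mul, flip_mul_self, Matrix.one_kronecker_one]

theorem star_copyFlip (j : Fin n) : star (copyFlip j) = copyFlip j := by
  rw [copyFlip_eq, Matrix.star_eq_conjTranspose, Matrix.conjTranspose_kronecker,
    ← Matrix.star_eq_conjTranspose, ← Matrix.star_eq_conjTranspose, star_one, star_flip]

theorem copyFlip_mul_lift (j : Fin n) (S : Mat n) :
    copyFlip j * lift S = lift S * copyFlip j := by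
  rw [copyFlip_eq, lift_eq, ← Matrix.mul_kronecker_mul, ← Matrix.mul_kronecker_mul]
  simp

theorem copyFlip_mul_copy (i j : Fin n) :
    copyFlip i * copy j = (if j = i then (-1 : ℂ) else 1) • (copy j * copyFlip i) := by
  rw [copyFlip_eq, copy_eq, ← Matrix.mul_kronecker_mul, ← Matrix.mul_kronecker_mul,
    flip_mul_fermion, Matrix.kronecker_smul, one_mul, mul_one]

theorem trace_lift (S : Mat n) : (lift S).trace = 2 ^ n * S.trace := by
  rw [lift_eq, Matrix.trace_kronecker, Matrix.trace_one, mul_comm]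
  simp

theorem lift_le {S : Mat n} {v : ℝ} (hS : S ≤ (v : ℂ) • 1) : lift S ≤ (v : ℂ) • 1 := by
  obtain ⟨C, hC⟩ := CStarAlgebra.nonneg_iff_eq_star_mul_self.mp (sub_nonneg.mpr hS)
  have h := congrArg lift hC
  rw [map_sub, map_smul, map_one, map_mul, map_star] at h
  rw [← sub_nonneg, h]
  exact star_mul_self_nonneg _

/-- The derivation `∑_j P_j D'_j T`, where the `P_j` are the second family of fermions. -/
noncomputable def gradient (T : Mat n) : DoubleMat n := ∑ j, copy j * lift (annihilate j T)

theorem copyFlip_conj_copy_mul_lift (i j : Fin n) (S : Mat n) :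
    copyFlip i * (copy j * lift S) * copyFlip i =
      (if j = i then (-1 : ℂ) else 1) • (copy j * lift S) := by
  rw [← mul_assoc, copyFlip_mul_copy, smul_mul_assoc, mul_assoc (copy j), copyFlip_mul_lift,
    smul_mul_assoc, mul_assoc, mul_assoc (lift S), copyFlip_mul_self, mul_one]

/-- Only the `j`-th summand contains `P_j`, so only it changes sign. -/
theorem copyFlip_conj_gradient (j : Fin n) (T : Mat n) :
    copyFlip j * gradient T * copyFlip j =
      gradient T - (2 : ℂ) • (copy j * lift (annihilate j T)) := by
  rw [gradient, Finset.mul_sum, Finset.sum_mul]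
  simp only [copyFlip_conj_copy_mul_lift]
  rw [← Finset.add_sum_erase _ _ (Finset.mem_univ j),
    ← Finset.add_sum_erase _ (fun i => copy i * lift (annihilate i T)) (Finset.mem_univ j)]
  rw [Finset.sum_congr rfl (g := fun i => copy i * lift (annihilate i T))
    (fun i hi => by rw [if_neg (Finset.ne_of_mem_erase hi), one_smul])]
  simp only [if_true, two_smul, neg_one_smul]
  abel

/-- The gradient is linear in the `P_j`: its odd parts add up to itself. Hence the integration by
parts applies with `d' = d`, without interpolation. -/
theorem gradient_moment_succ_le (T : Mat n) (p : ℕ) :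
    ((star (gradient T) * gradient T) ^ (p + 1)).trace.re ≤
      (2 * p + 1) * normInf (gradNorm T) ^ 2 *
        ((star (gradient T) * gradient T) ^ p).trace.re := by
  set Z := gradient T with hZ
  have hflip : ∀ j : Fin n, copyFlip j * (copy j * lift (annihilate j T)) * copyFlip j =
      -(copy j * lift (annihilate j T)) := fun j => by simp [copyFlip_conj_copy_mul_lift]
  have h₁ : ∑ j, (copy j * lift (annihilate j T)) * star (copy j * lift (annihilate j T)) ≤
      ((normInf (gradNorm T) ^ 2 : ℝ) : ℂ) • 1 := by
    have h : ∀ j, (copy j * lift (annihilate j T)) * star (copy j * lift (annihilate j T)) =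
        lift (parity n * (annihilate j T * star (annihilate j T)) * parity n) := by
      intro j
      rw [← copy_conj_lift j, star_mul, star_copy, ← map_star, map_mul]
      simp only [mul_assoc]
    rw [Finset.sum_congr rfl fun j _ => h j, ← map_sum, ← Finset.sum_mul, ← Finset.mul_sum]
    exact lift_le (parity_conj_le (sum_annihilate_mul_star_le T))
  have h₂ : ∑ j, star (copy j * lift (annihilate j T)) * (copy j * lift (annihilate j T)) ≤
      ((normInf (gradNorm T) ^ 2 : ℝ) : ℂ) • 1 := by
    have h : ∀ j, star (copy j * lift (annihilate j T)) * (copy j * lift (annihilate j T)) =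
        lift (star (annihilate j T) * annihilate j T) := by
      intro j
      rw [star_mul, star_copy, mul_assoc, ← mul_assoc (copy j), copy_mul_self, one_mul, ← map_star,
        map_mul]
    rw [Finset.sum_congr rfl fun j _ => h j, ← map_sum]
    exact lift_le (sum_star_annihilate_mul_le T)
  have key := sum_trace_star_mul_le (T := Z) (V := copyFlip)
    (d := fun j => copy j * lift (annihilate j T)) (d' := fun j => copy j * lift (annihilate j T))
    (v := normInf (gradNorm T) ^ 2) copyFlip_mul_self star_copyFlip
    (fun j => copyFlip_conj_gradient j T) hflip h₁ h₂ h₁ h₂ p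
  refine le_trans (le_of_eq ?_) key
  rw [← Complex.re_sum, ← Matrix.trace_sum, ← Finset.sum_mul, ← star_sum]
  change _ = (star Z * _).trace.re
  rw [pow_succ', mul_assoc]

theorem gradient_moment_le (T : Mat n) (p : ℕ) :
    ((star (gradient T) * gradient T) ^ p).trace.re ≤
      gaussianMoment p * (normInf (gradNorm T) ^ 2) ^ p * (2 ^ n * 2 ^ n) := by
  have h := le_gaussianMoment_of_recursion
    (m := fun p => ((star (gradient T) * gradient T) ^ p).trace.re)
    (sq_nonneg _) (gradient_moment_succ_le T) p
  have h1 : (1 : DoubleMat n).trace.re = 2 ^ n * 2 ^ n := by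
    rw [Matrix.trace_one]
    simp only [Fintype.card_prod, Fintype.card_fun, Fintype.card_fin]
    norm_cast
  simpa only [pow_zero, h1] using h

/-! ### Rotations mixing the two families -/

/-- The plane rotation `Q_j ↦ cos θ Q_j + sin θ P_j`, as a unitary. -/
noncomputable def rotor (θ : ℝ) (j : Fin n) : DoubleMat n :=
  (Real.cos (θ / 2) : ℂ) • 1 + (Real.sin (θ / 2) : ℂ) • (copy j * lift (fermion j))

theorem lift_fermion_mul_self (j : Fin n) :
    lift (fermion j) * lift (fermion j) = (1 : DoubleMat n) := by
  rw [← map_mul, fermion_mul_self, map_one]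

theorem star_rotor (θ : ℝ) (j : Fin n) : star (rotor θ j) =
    (Real.cos (θ / 2) : ℂ) • 1 - (Real.sin (θ / 2) : ℂ) • (copy j * lift (fermion j)) := by
  rw [rotor, star_add, star_smul, star_smul, star_one, star_mul, star_copy, ← map_star,
    star_fermion, copy_mul_lift_fermion, Complex.star_def, Complex.conj_ofReal, Complex.conj_ofReal,
    smul_neg, sub_neg_eq_add]

theorem cos_sq_add_sin_sq_half (θ : ℝ) :
    (Real.cos (θ / 2) : ℂ) * Real.cos (θ / 2) + (Real.sin (θ / 2) : ℂ) * Real.sin (θ / 2) = 1 := by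
  rw [← Complex.ofReal_mul, ← Complex.ofReal_mul, ← Complex.ofReal_add, ← sq, ← sq,
    Real.cos_sq_add_sin_sq, Complex.ofReal_one]

theorem cos_half (θ : ℝ) : (Real.cos θ : ℂ) =
    (Real.cos (θ / 2) : ℂ) * Real.cos (θ / 2) - (Real.sin (θ / 2) : ℂ) * Real.sin (θ / 2) := by
  conv_lhs => rw [← add_halves θ, Real.cos_add]
  push_cast; ring

theorem sin_half (θ : ℝ) : (Real.sin θ : ℂ) =
    2 * ((Real.sin (θ / 2) : ℂ) * Real.cos (θ / 2)) := by
  conv_lhs => rw [← add_halves θ, Real.sin_add]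
  push_cast; ring

section Relations

variable (j : Fin n)

theorem bivector_mul_fermion :
    copy j * lift (fermion j) * lift (fermion j) = copy j := by
  rw [mul_assoc, lift_fermion_mul_self, mul_one]

theorem fermion_mul_bivector :
    lift (fermion j) * (copy j * lift (fermion j)) = -copy j := by
  rw [copy_mul_lift_fermion, mul_neg, ← mul_assoc, lift_fermion_mul_self, one_mul]

theorem copy_mul_bivector :
    copy j * (copy j * lift (fermion j)) = lift (fermion j) := by
  rw [← mul_assoc, copy_mul_self, one_mul]

theorem bivector_mul_copy :
    copy j * lift (fermion j) * copy j = -lift (fermion j) := by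
  rw [copy_mul_lift_fermion, neg_mul, mul_assoc, copy_mul_self, mul_one]

end Relations

/-- The bivector `P_j Q'_j` is skew-adjoint with square `-1`, so the rotor is its exponential at
`θ/2`; conjugation doubles the angle. -/
theorem star_rotor_mul_rotor (θ : ℝ) (j : Fin n) : star (rotor θ j) * rotor θ j = 1 := by
  have hB : (copy j * lift (fermion j)) * (copy j * lift (fermion j)) = (-1 : DoubleMat n) := by
    rw [← mul_assoc, bivector_mul_copy, neg_mul, lift_fermion_mul_self]
  rw [star_rotor, rotor]
  set B := copy j * lift (fermion j)
  simp only [sub_mul, mul_add, smul_mul_smul_comm, mul_one, one_mul, hB]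
  have h := cos_sq_add_sin_sq_half θ
  calc _ = ((Real.cos (θ / 2) : ℂ) * Real.cos (θ / 2) +
        (Real.sin (θ / 2) : ℂ) * Real.sin (θ / 2)) • (1 : DoubleMat n) := by module
    _ = 1 := by rw [h, one_smul]

theorem rotor_conj_fermion (θ : ℝ) (j : Fin n) :
    rotor θ j * lift (fermion j) * star (rotor θ j) =
      (Real.cos θ : ℂ) • lift (fermion j) + (Real.sin θ : ℂ) • copy j := by
  have h1 := bivector_mul_fermion j
  have h2 := fermion_mul_bivector j
  have h3 := copy_mul_bivector j
  rw [star_rotor, rotor, cos_half θ, sin_half θ]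
  set B := copy j * lift (fermion j)
  simp only [mul_sub, add_mul, smul_mul_assoc, mul_smul_comm, mul_one, one_mul, h1, h2, h3]
  module

theorem rotor_conj_copy (θ : ℝ) (j : Fin n) :
    rotor θ j * copy j * star (rotor θ j) =
      (-Real.sin θ : ℂ) • lift (fermion j) + (Real.cos θ : ℂ) • copy j := by
  have h1 := bivector_mul_copy j
  have h2 := fermion_mul_bivector j
  have h3 := copy_mul_bivector j
  rw [star_rotor, rotor, cos_half θ, sin_half θ]
  set B := copy j * lift (fermion j)
  simp only [mul_sub, add_mul, smul_mul_assoc, mul_smul_comm, mul_one, one_mul, h1, h2, h3,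
    neg_mul]
  module

/-- A bivector is a product of two elements that anticommute with both fermions of index `j`, so the
signs cancel. -/
theorem rotor_mul_of_ne {i j : Fin n} (h : i ≠ j) (θ : ℝ) (a b : ℂ) :
    rotor θ i * (a • lift (fermion j) + b • copy j) =
      (a • lift (fermion j) + b • copy j) * rotor θ i := by
  have e1 : copy i * lift (fermion i) * lift (fermion j) =
      lift (fermion j) * (copy i * lift (fermion i)) := by
    rw [mul_assoc, ← map_mul, fermion_anticomm i j h, map_neg, map_mul, mul_neg, ← mul_assoc,
      copy_mul_lift_fermion, neg_mul, neg_neg, mul_assoc]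
  have e2 : copy i * lift (fermion i) * copy j = copy j * (copy i * lift (fermion i)) := by
    rw [← mul_assoc, copy_anticomm h.symm, mul_assoc, neg_mul, mul_assoc, copy_mul_lift_fermion j i,
      mul_neg, neg_neg]
  rw [rotor]
  simp only [mul_add, add_mul, smul_mul_assoc, mul_smul_comm, mul_one, one_mul, e1, e2]
  module

theorem rotor_conj_of_ne {i j : Fin n} (h : i ≠ j) (θ : ℝ) (a b : ℂ) :
    rotor θ i * (a • lift (fermion j) + b • copy j) * star (rotor θ i) =
      a • lift (fermion j) + b • copy j := by
  rw [rotor_mul_of_ne h, mul_assoc, mul_eq_one_comm.mp (star_rotor_mul_rotor θ i), mul_one]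

/-- The product of the rotations of the factors in a list. -/
noncomputable def rotors (θ : ℝ) (l : List (Fin n)) : DoubleMat n := (l.map (rotor θ)).prod

theorem star_rotors_mul_rotors (θ : ℝ) (l : List (Fin n)) :
    star (rotors θ l) * rotors θ l = 1 := by
  induction l with
  | nil => simp [rotors]
  | cons j l ih =>
    rw [rotors, List.map_cons, List.prod_cons, star_mul, mul_assoc, ← mul_assoc (star (rotor θ j)),
      star_rotor_mul_rotor, one_mul]
    exact ih

/-- Only the rotor of index `j` moves `x`; the others fix both `x` and its image, so the order of
the list is immaterial. -/
theorem rotors_conj (θ : ℝ) {x x' : DoubleMat n} {j : Fin n} {a b : ℂ}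
    (hx' : x' = a • lift (fermion j) + b • copy j) (hj : rotor θ j * x * star (rotor θ j) = x')
    (hi : ∀ i, i ≠ j → rotor θ i * x * star (rotor θ i) = x) {l : List (Fin n)} (hl : l.Nodup) :
    rotors θ l * x * star (rotors θ l) = if j ∈ l then x' else x := by
  induction l with
  | nil => simp [rotors]
  | cons i l ih =>
    obtain ⟨h1, h2⟩ := List.nodup_cons.mp hl
    have e : rotors θ (i :: l) * x * star (rotors θ (i :: l)) =
        rotor θ i * (rotors θ l * x * star (rotors θ l)) * star (rotor θ i) := by
      simp only [rotors, List.map_cons, List.prod_cons, star_mul, mul_assoc]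
    rw [e, ih h2]
    by_cases hij : i = j
    · subst hij
      simp [h1, hj]
    · have hji : ¬ j = i := fun h => hij h.symm
      simp only [List.mem_cons, hji, false_or]
      split_ifs
      · rw [hx', rotor_conj_of_ne hij]
      · exact hi i hij

/-- The second quantization of the rotation by `θ`. -/
noncomputable def rotate (θ : ℝ) (x : DoubleMat n) : DoubleMat n :=
  rotors θ Finset.univ.toList * x * star (rotors θ Finset.univ.toList)

theorem rotate_fermion (θ : ℝ) (j : Fin n) : rotate θ (lift (fermion j)) =
    (Real.cos θ : ℂ) • lift (fermion j) + (Real.sin θ : ℂ) • copy j := by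
  rw [rotate, rotors_conj θ rfl (rotor_conj_fermion θ j) _ (Finset.nodup_toList _)]
  · simp
  · intro i hi
    simpa using rotor_conj_of_ne hi θ 1 0

theorem rotate_copy (θ : ℝ) (j : Fin n) : rotate θ (copy j) =
    (-Real.sin θ : ℂ) • lift (fermion j) + (Real.cos θ : ℂ) • copy j := by
  rw [rotate, rotors_conj θ rfl (rotor_conj_copy θ j) _ (Finset.nodup_toList _)]
  · simp
  · intro i hi
    simpa using rotor_conj_of_ne hi θ 0 1

theorem rotate_mul (θ : ℝ) (x y : DoubleMat n) : rotate θ (x * y) = rotate θ x * rotate θ y := by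
  simp only [rotate, mul_assoc]
  rw [← mul_assoc (star _) (rotors θ _), star_rotors_mul_rotors, one_mul]

theorem rotate_one (θ : ℝ) : rotate θ (1 : DoubleMat n) = 1 := by
  rw [rotate, mul_one, mul_eq_one_comm.mp (star_rotors_mul_rotors θ _)]

theorem rotate_sum (θ : ℝ) {κ : Type*} (s : Finset κ) (x : κ → DoubleMat n) :
    rotate θ (∑ i ∈ s, x i) = ∑ i ∈ s, rotate θ (x i) := by
  simp only [rotate, Finset.mul_sum, Finset.sum_mul]

theorem rotate_smul (θ : ℝ) (c : ℂ) (x : DoubleMat n) : rotate θ (c • x) = c • rotate θ x := by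
  simp only [rotate, mul_smul_comm, smul_mul_assoc]

theorem rotate_zero (θ : ℝ) : rotate θ (0 : DoubleMat n) = 0 := by simp [rotate]

theorem star_rotate (θ : ℝ) (x : DoubleMat n) : star (rotate θ x) = rotate θ (star x) := by
  simp only [rotate, star_mul, star_star, mul_assoc]

theorem rotate_pow (θ : ℝ) (x : DoubleMat n) (p : ℕ) : rotate θ (x ^ p) = rotate θ x ^ p := by
  induction p with
  | zero => rw [pow_zero, pow_zero, rotate_one]
  | succ p ih => rw [pow_succ, pow_succ, rotate_mul, ih]

theorem trace_rotate (θ : ℝ) (x : DoubleMat n) : (rotate θ x).trace = x.trace := by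
  rw [rotate, Matrix.trace_mul_comm, ← mul_assoc, star_rotors_mul_rotors, one_mul]

theorem trace_rotate_moment (θ : ℝ) (x : DoubleMat n) (p : ℕ) :
    ((star (rotate θ x) * rotate θ x) ^ p).trace = ((star x * x) ^ p).trace := by
  rw [star_rotate, ← rotate_mul, ← rotate_pow, trace_rotate]

/-! ### Pairing the rotated gradient with the first algebra -/

/-- The trace of a product of rotated fermions against an element of the first factor. -/
theorem trace_list_prod_mul_lift (a b : Fin n → ℂ) {l : List (Fin n)} (hl : l.Nodup) (y : Mat n) :
    ((l.map fun i => a i • lift (fermion i) + b i • copy i).prod * lift y).trace =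
      2 ^ n * ((l.map a).prod * ((l.map fermion).prod * y).trace) := by
  induction l generalizing y with
  | nil => simp [trace_lift]
  | cons i l ih =>
    obtain ⟨h1, h2⟩ := List.nodup_cons.mp hl
    set X : DoubleMat n := (l.map fun i => a i • lift (fermion i) + b i • copy i).prod with hX
    have hcomm : copyFlip i * X = X * copyFlip i := by
      refine Commute.list_prod_right _ _ fun x hx => ?_
      obtain ⟨k, hk, rfl⟩ := List.mem_map.mp hx
      have hki : k ≠ i := fun h => h1 (h ▸ hk)
      simp only [Commute, SemiconjBy, mul_add, add_mul, mul_smul_comm, smul_mul_assoc,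
        copyFlip_mul_lift, copyFlip_mul_copy, if_neg hki, one_smul]
    -- No other factor contains `P_i`, so this term is odd under `copyFlip i` and has trace zero.
    have hzero : (copy i * (X * lift y)).trace = 0 := by
      have e : copyFlip i * (copy i * (X * lift y)) * copyFlip i = -(copy i * (X * lift y)) := by
        rw [← mul_assoc, copyFlip_mul_copy, if_pos rfl, neg_one_smul, neg_mul, neg_mul, mul_assoc,
          mul_assoc, mul_assoc X, ← copyFlip_mul_lift, ← mul_assoc X, ← hcomm, mul_assoc,
          ← mul_assoc (copyFlip i) (copyFlip i), copyFlip_mul_self, one_mul]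
      have e2 := congrArg Matrix.trace e
      rw [Matrix.trace_mul_comm, ← mul_assoc, copyFlip_mul_self, one_mul, Matrix.trace_neg] at e2
      exact self_eq_neg.mp e2
    -- Cyclicity absorbs the leading fermion into `y`, which is why `y` is generalized in the
    -- induction.
    have hmain : (lift (fermion i) * (X * lift y)).trace =
        2 ^ n * ((l.map a).prod * ((l.map fermion).prod * (y * fermion i)).trace) := by
      rw [Matrix.trace_mul_comm, mul_assoc, ← map_mul, ih h2]
    rw [List.map_cons, List.prod_cons, mul_assoc, add_mul, smul_mul_assoc, smul_mul_assoc,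
      Matrix.trace_add, Matrix.trace_smul, Matrix.trace_smul, hzero, hmain, smul_zero, add_zero,
      List.map_cons, List.prod_cons, List.map_cons, List.prod_cons, smul_eq_mul,
      ← mul_assoc _ y (fermion i), Matrix.trace_mul_comm _ (fermion i), mul_assoc (fermion i)]
    ring

theorem rotate_lift_fermionProd (θ : ℝ) (A : Finset (Fin n)) : rotate θ (lift (fermionProd A)) =
    ((A.sort (· ≤ ·)).map fun i =>
      (Real.cos θ : ℂ) • lift (fermion i) + (Real.sin θ : ℂ) • copy i).prod := by
  rw [fermionProd]
  induction A.sort (· ≤ ·) with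
  | nil => simp [rotate_one]
  | cons i l ih => rw [List.map_cons, List.prod_cons, map_mul, rotate_mul, ih, rotate_fermion,
      List.map_cons, List.prod_cons]

/-- Only the components along the first family survive the trace: `-sin θ` from `P_j`, and `cos θ`
from each of the other `|A| - 1` factors. -/
theorem trace_rotate_copy_mul (θ : ℝ) {j : Fin n} {A : Finset (Fin n)} (hj : j ∈ A) (y : Mat n) :
    (rotate θ (copy j * lift (fermion j * fermionProd A)) * lift y).trace =
      2 ^ n * ((-Real.sin θ * Real.cos θ ^ (A.card - 1) : ℝ) * (fermionProd A * y).trace) := by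
  obtain ⟨s, hs, h⟩ := exists_sign_fermion_mul_of_mem hj
  set l := (A.erase j).sort (· ≤ ·) with hl
  have hjl : j ∉ l := by simp [hl]
  have hnd : (j :: l).Nodup := List.nodup_cons.mpr ⟨hjl, Finset.sort_nodup _ _⟩
  set a : Fin n → ℂ := fun i => if i = j then -Real.sin θ else Real.cos θ with ha
  set b : Fin n → ℂ := fun i => if i = j then Real.cos θ else Real.sin θ with hb
  have hne : ∀ i ∈ l, i ≠ j := fun i hi h => hjl (h ▸ hi)
  have e1 : rotate θ (copy j * lift (fermionProd (A.erase j))) =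
      ((j :: l).map fun i => a i • lift (fermion i) + b i • copy i).prod := by
    rw [rotate_mul, rotate_copy, rotate_lift_fermionProd, List.map_cons, List.prod_cons]
    congr 1
    · simp [ha, hb]
    · congr 1
      refine List.map_congr_left fun i hi => ?_
      simp [ha, hb, hne i hi]
  have e2 : (l.map a).prod = (Real.cos θ : ℂ) ^ (A.card - 1) := by
    rw [List.map_congr_left (g := fun _ => (Real.cos θ : ℂ))
      (fun i hi => by simp [ha, hne i hi])]
    simp [hl, Finset.card_erase_of_mem hj]
  have e3 : fermion j * (l.map fermion).prod = s • fermionProd A := by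
    change fermion j * fermionProd (A.erase j) = _
    have : fermionProd (A.erase j) = s • (fermion j * fermionProd A) := by
      rw [h, smul_smul, hs, one_smul]
    rw [this, mul_smul_comm, ← mul_assoc, fermion_mul_self, one_mul]
  rw [h, map_smul, mul_smul_comm, rotate_smul, smul_mul_assoc, Matrix.trace_smul, e1,
    trace_list_prod_mul_lift a b hnd, List.map_cons, List.prod_cons, e2, List.map_cons,
    List.prod_cons, e3, smul_mul_assoc, Matrix.trace_smul, smul_eq_mul, smul_eq_mul]
  have ha' : a j = -Real.sin θ := by simp [ha]
  rw [ha']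
  push_cast
  linear_combination (2 ^ n * (-Complex.sin θ * Complex.cos θ ^ (A.card - 1) *
    (fermionProd A * y).trace)) * hs

/-- Summing over `j ∈ A` turns the coefficient into `|A| (-sin θ) cos^(|A|-1) θ`, the derivative of
`cos^|A| θ`. -/
theorem trace_rotate_gradient_mul (θ : ℝ) (T y : Mat n) :
    (rotate θ (gradient T) * lift y).trace =
      2 ^ n * ∑ A : Finset (Fin n), ((A.card * (-Real.sin θ * Real.cos θ ^ (A.card - 1)) : ℝ) : ℂ) *
        (coeff A T * (fermionProd A * y).trace) := by
  have h : ∀ j, (rotate θ (copy j * lift (annihilate j T)) * lift y).trace =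
      ∑ A : Finset (Fin n), if j ∈ A then 2 ^ n *
        ((-Real.sin θ * Real.cos θ ^ (A.card - 1) : ℝ) *
          (coeff A T * (fermionProd A * y).trace)) else 0 := by
    intro j
    rw [annihilate, map_sum, Finset.mul_sum, rotate_sum, Finset.sum_mul, Matrix.trace_sum]
    refine Finset.sum_congr rfl fun A _ => ?_
    split_ifs with hj
    · rw [map_smul, mul_smul_comm, rotate_smul, smul_mul_assoc, Matrix.trace_smul,
        trace_rotate_copy_mul θ hj, smul_eq_mul]
      ring
    · simp [rotate_zero]
  rw [gradient, rotate_sum, Finset.sum_mul, Matrix.trace_sum, Finset.sum_congr rfl fun j _ => h j,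
    Finset.sum_comm, Finset.mul_sum]
  refine Finset.sum_congr rfl fun A _ => ?_
  rw [Finset.sum_ite_mem, Finset.univ_inter, Finset.sum_const, nsmul_eq_mul]
  push_cast
  ring

/-! ### The weight and the subordination formula -/

theorem neg_log_cos_nonneg (θ : ℝ) : 0 ≤ -Real.log (Real.cos θ) := by
  rw [← Real.log_abs, neg_nonneg]
  exact Real.log_nonpos (abs_nonneg _) (Real.abs_cos_le_one θ)

theorem weight_nonneg (α θ : ℝ) : 0 ≤ weight α θ := Real.rpow_nonneg (neg_log_cos_nonneg θ) _

/-- Combines `log x ≤ x - 1` with a quadratic upper bound for the cosine. It makes the weight at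
most a constant times `θ^(-2α)`, which is integrable for `2α < 1`. -/
theorem two_div_pi_sq_mul_sq_le {θ : ℝ} (h0 : 0 < θ) (h1 : θ < Real.pi / 2) :
    2 / Real.pi ^ 2 * θ ^ 2 ≤ -Real.log (Real.cos θ) := by
  have hcos : 0 < Real.cos θ := Real.cos_pos_of_mem_Ioo ⟨by linarith [Real.pi_pos], h1⟩
  have h2 := Real.log_le_sub_one_of_pos hcos
  have h3 := Real.cos_le_one_sub_mul_cos_sq (x := θ)
    (by rw [abs_of_pos h0]; linarith [Real.pi_pos])
  linarith

theorem intervalIntegrable_weight {α : ℝ} (h0 : 0 < α) (h1 : α < 1 / 2) :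
    IntervalIntegrable (weight α) MeasureTheory.volume 0 (Real.pi / 2) := by
  have hpi := Real.pi_pos
  have hmeas : Measurable (weight α) := by
    unfold weight
    exact ((Real.measurable_log.comp Real.measurable_cos).neg).pow_const _
  have hg : IntervalIntegrable (fun θ : ℝ => (2 / Real.pi ^ 2) ^ (-α) * θ ^ (2 * (-α)))
      MeasureTheory.volume 0 (Real.pi / 2) :=
    (intervalIntegral.intervalIntegrable_rpow' (by linarith)).const_mul _
  refine hg.mono_fun' hmeas.aestronglyMeasurable ?_
  rw [Filter.EventuallyLE, MeasureTheory.ae_restrict_iff' measurableSet_uIoc]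
  refine Filter.Eventually.of_forall fun θ hθ => ?_
  rw [Set.uIoc_of_le (by positivity)] at hθ
  have hθ0 : 0 < θ := hθ.1
  rw [Real.norm_eq_abs, abs_of_nonneg (weight_nonneg α θ)]
  rcases hθ.2.lt_or_eq with h | h
  · rw [Real.rpow_mul hθ0.le, ← Real.mul_rpow (by positivity) (by positivity), Real.rpow_two]
    exact Real.rpow_le_rpow_of_nonpos (by positivity) (two_div_pi_sq_mul_sq_le hθ0 h) (by linarith)
  -- At `π/2` the conventions `log 0 = 0` and `0^(-α) = 0` make the weight vanish.
  · rw [weight, h, Real.cos_pi_div_two, Real.log_zero, neg_zero, Real.zero_rpow (by linarith)]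
    positivity

theorem image_neg_log_cos :
    (fun θ => -Real.log (Real.cos θ)) '' Set.Ioo 0 (Real.pi / 2) = Set.Ioi 0 := by
  ext u
  constructor
  · rintro ⟨θ, hθ, rfl⟩
    have := two_div_pi_sq_mul_sq_le hθ.1 hθ.2
    have h : 0 < 2 / Real.pi ^ 2 * θ ^ 2 := mul_pos (by positivity) (pow_pos hθ.1 2)
    exact h.trans_le this
  · intro hu
    have hu : 0 < u := hu
    have h1 : Real.exp (-u) < 1 := by simpa using Real.exp_lt_exp.mpr (neg_lt_zero.mpr hu)
    have h0 := Real.exp_pos (-u)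
    refine ⟨Real.arccos (Real.exp (-u)), ⟨Real.arccos_pos.mpr h1, Real.arccos_lt_pi_div_two.mpr h0⟩,
      ?_⟩
    simp only
    rw [Real.cos_arccos (by linarith) h1.le, Real.log_exp, neg_neg]

/-- The subordination formula `k^α Γ(1-α) = ∫ (-log cos θ)^{-α} k sin θ cos^{k-1} θ dθ`. -/
theorem integral_weight_mul {α : ℝ} (h0 : 0 < α) (h1 : α < 1) (k : ℕ) :
    ∫ θ in (0 : ℝ)..(Real.pi / 2), weight α θ * (k * (Real.sin θ * Real.cos θ ^ (k - 1))) =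
      Real.Gamma (1 - α) * (k : ℝ) ^ α := by
  rcases Nat.eq_zero_or_pos k with rfl | hk
  · simp [Real.zero_rpow h0.ne']
  have hk' : (0 : ℝ) < k := by exact_mod_cast hk
  have hcos : ∀ θ ∈ Set.Ioo 0 (Real.pi / 2), 0 < Real.cos θ := fun θ hθ =>
    Real.cos_pos_of_mem_Ioo ⟨by linarith [Real.pi_pos, hθ.1], hθ.2⟩
  have hderiv : ∀ θ ∈ Set.Ioo 0 (Real.pi / 2), HasDerivWithinAt
      (fun θ => -Real.log (Real.cos θ)) (Real.sin θ / Real.cos θ) (Set.Ioo 0 (Real.pi / 2)) θ := by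
    intro θ hθ
    have h := ((Real.hasDerivAt_cos θ).log (hcos θ hθ).ne').neg
    rw [neg_div, neg_neg] at h
    exact h.hasDerivWithinAt
  have hinj : Set.InjOn (fun θ => -Real.log (Real.cos θ)) (Set.Ioo 0 (Real.pi / 2)) := by
    intro x hx y hy hxy
    have h := Real.log_injOn_pos (hcos x hx) (hcos y hy) (neg_injective hxy)
    exact Real.injOn_cos ⟨hx.1.le, by linarith [hx.2, Real.pi_pos]⟩
      ⟨hy.1.le, by linarith [hy.2, Real.pi_pos]⟩ h
  -- Substitute `u = -log cos θ`: then `du = tan θ dθ` and `exp(-ku) = cos^k θ`, and the integral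
  -- becomes Euler's for `Γ(1-α)`.
  have key := MeasureTheory.integral_image_eq_integral_abs_deriv_smul measurableSet_Ioo hderiv hinj
    (fun u => u ^ ((1 - α) - 1) * Real.exp (-(k * u)))
  rw [image_neg_log_cos, Real.integral_rpow_mul_exp_neg_mul_Ioi (by linarith) hk'] at key
  rw [intervalIntegral.integral_of_le (by positivity), MeasureTheory.integral_Ioc_eq_integral_Ioo]
  have e : ∀ θ ∈ Set.Ioo 0 (Real.pi / 2),
      weight α θ * (k * (Real.sin θ * Real.cos θ ^ (k - 1))) =
        k * (|Real.sin θ / Real.cos θ| • ((-Real.log (Real.cos θ)) ^ ((1 - α) - 1) *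
          Real.exp (-(k * -Real.log (Real.cos θ))))) := by
    intro θ hθ
    have hc := hcos θ hθ
    have hs : 0 < Real.sin θ := Real.sin_pos_of_pos_of_lt_pi hθ.1 (by linarith [hθ.2, Real.pi_pos])
    have hexp : Real.exp (-(k * -Real.log (Real.cos θ))) = Real.cos θ ^ (k - 1) * Real.cos θ := by
      rw [← pow_succ, Nat.sub_add_cancel hk, mul_neg, neg_neg, Real.exp_nat_mul, Real.exp_log hc]
    rw [hexp, abs_of_pos (by positivity), weight, smul_eq_mul, show 1 - α - 1 = -α by ring]
    field_simp
  rw [MeasureTheory.setIntegral_congr_fun measurableSet_Ioo e, MeasureTheory.integral_const_mul,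
    ← key, one_div, Real.inv_rpow hk'.le, Real.rpow_sub hk', Real.rpow_one]
  have : (0 : ℝ) < (k : ℝ) ^ α := Real.rpow_pos_of_pos hk' α
  field_simp

theorem gamma_mul_constK {α : ℝ} (h1 : α < 1) :
    ∫ θ in (0 : ℝ)..(Real.pi / 2), weight α θ = Real.Gamma (1 - α) * constK α := by
  have hΓ : Real.Gamma (1 - α) ≠ 0 := (Real.Gamma_pos_of_pos (by linarith)).ne'
  rw [constK]
  simp only [abs_of_nonneg (weight_nonneg α _)]
  field_simp

/-- The subordination formula for `k = 1` has integral `Γ(1-α)`, and `sin θ ≤ 1` then even gives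
`K_α ≥ 1`. -/
theorem constK_pos {α : ℝ} (h0 : 0 < α) (h1 : α < 1 / 2) : 0 < constK α := by
  have hΓ : 0 < Real.Gamma (1 - α) := Real.Gamma_pos_of_pos (by linarith)
  have h := integral_weight_mul h0 (by linarith) 1
  have hw := intervalIntegrable_weight h0 h1
  have hle : ∫ θ in (0 : ℝ)..(Real.pi / 2),
      weight α θ * ((1 : ℕ) * (Real.sin θ * Real.cos θ ^ (1 - 1))) ≤
        ∫ θ in (0 : ℝ)..(Real.pi / 2), weight α θ := by
    refine intervalIntegral.integral_mono_on (by positivity) (hw.mul_continuousOn (by fun_prop)) hw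
      fun θ _ => ?_
    have := mul_le_mul_of_nonneg_left (Real.sin_le_one θ) (weight_nonneg α θ)
    simpa using this
  rw [h, gamma_mul_constK (by linarith)] at hle
  simp only [Nat.cast_one, Real.one_rpow] at hle
  have := le_of_mul_le_mul_left hle hΓ
  linarith

/-! ### Moments and tail of the powers of the number operator -/

/-- The trace pairing of `∇T`, rotated, with an element of the first factor. -/
theorem trace_rotate_gradient_le (θ K : ℝ) (T b : Mat n) (p : ℕ) :
    K * (2 ^ n * ∑ A : Finset (Fin n), (A.card * (Real.sin θ * Real.cos θ ^ (A.card - 1))) *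
        (coeff A T * (fermionProd A * star (b * (star b * b) ^ p)).trace).re) ≤
      (K ^ (2 * (p + 1)) * ((star (gradient T) * gradient T) ^ (p + 1)).trace.re +
        (2 * p + 1) * (2 ^ n * ((star b * b) ^ (p + 1)).trace.re)) / (2 * p + 2) := by
  -- The angle is `-θ` so that the coefficient comes out as `+sin θ`.
  have h := trace_star_mul_le_young ((K : ℂ) • rotate (-θ) (gradient T)) (lift b) p
  have e1 : ((star ((K : ℂ) • rotate (-θ) (gradient T)) *
      ((K : ℂ) • rotate (-θ) (gradient T))) ^ (p + 1)).trace.re =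
      K ^ (2 * (p + 1)) * ((star (gradient T) * gradient T) ^ (p + 1)).trace.re := by
    rw [star_smul, smul_mul_smul_comm, smul_pow, Matrix.trace_smul, trace_rotate_moment,
      Complex.star_def, Complex.conj_ofReal, smul_eq_mul, ← Complex.ofReal_mul,
      ← Complex.ofReal_pow, Complex.re_ofReal_mul, ← sq, ← pow_mul]
  have e2 : ((star (lift b) * lift b) ^ (p + 1)).trace.re =
      2 ^ n * ((star b * b) ^ (p + 1)).trace.re := by
    rw [← map_star, ← map_mul, ← map_pow, trace_lift]
    have : (2 : ℂ) ^ n = ((2 ^ n : ℝ) : ℂ) := by push_cast; rfl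
    rw [this, Complex.re_ofReal_mul]
  have e3 : (star ((K : ℂ) • rotate (-θ) (gradient T)) *
      (lift b * (star (lift b) * lift b) ^ p)).trace.re =
      K * (2 ^ n * ∑ A : Finset (Fin n), (A.card * (Real.sin θ * Real.cos θ ^ (A.card - 1))) *
        (coeff A T * (fermionProd A * star (b * (star b * b) ^ p)).trace).re) := by
    have f1 : lift b * (star (lift b) * lift b) ^ p = star (lift (star (b * (star b * b) ^ p))) := by
      rw [map_star lift (b * (star b * b) ^ p), star_star, map_mul, map_pow, map_mul, map_star]
    rw [f1, ← star_mul, Matrix.star_eq_conjTranspose, Matrix.trace_conjTranspose, Complex.star_def,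
      Complex.conj_re, Matrix.trace_mul_comm, smul_mul_assoc, Matrix.trace_smul, smul_eq_mul,
      Complex.re_ofReal_mul, trace_rotate_gradient_mul]
    have : (2 : ℂ) ^ n = ((2 ^ n : ℝ) : ℂ) := by push_cast; rfl
    rw [this, Complex.re_ofReal_mul, Complex.re_sum]
    simp only [Complex.re_ofReal_mul, Real.sin_neg, Real.cos_neg, neg_neg]
  rwa [e1, e2, e3] at h

theorem trace_numberPow_mul (α : ℝ) (T y : Mat n) :
    (numberPow α T * y).trace.re =
      ∑ A : Finset (Fin n), (A.card : ℝ) ^ α * (coeff A T * (fermionProd A * y).trace).re := by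
  rw [numberPow, Finset.sum_mul, Matrix.trace_sum, Complex.re_sum]
  refine Finset.sum_congr rfl fun A _ => ?_
  rw [smul_mul_assoc, smul_mul_assoc, Matrix.trace_smul, Matrix.trace_smul, smul_eq_mul,
    smul_eq_mul, Complex.re_ofReal_mul]

/-- By subordination, pairing the rotated gradient with the dual element `b (b* b)^p` and averaging
over `θ` reproduces the moment of `b = N'^α T`. Young's inequality under the integral replaces
Hölder's; the scale `K` is the total mass of the weight divided by `Γ(1-α)`. -/
theorem numberPow_moment_succ_le {α : ℝ} (h0 : 0 < α) (h1 : α < 1 / 2) (T : Mat n) (p : ℕ) :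
    2 ^ n * ((star (numberPow α T) * numberPow α T) ^ (p + 1)).trace.re ≤
      constK α ^ (2 * (p + 1)) * ((star (gradient T) * gradient T) ^ (p + 1)).trace.re := by
  set b := numberPow α T with hb
  set K := constK α with hK
  have hKpos : 0 < K := constK_pos h0 h1
  have hΓ : 0 < Real.Gamma (1 - α) := Real.Gamma_pos_of_pos (by linarith)
  have hw := intervalIntegrable_weight h0 h1
  set m := ((star b * b) ^ (p + 1)).trace.re with hm
  set z := ((star (gradient T) * gradient T) ^ (p + 1)).trace.re with hz
  set β : Finset (Fin n) → ℝ := fun A =>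
    (coeff A T * (fermionProd A * star (b * (star b * b) ^ p)).trace).re with hβ
  set C : ℝ := (K ^ (2 * (p + 1)) * z + (2 * p + 1) * (2 ^ n * m)) / (2 * p + 2) with hC
  have hm' : m = ∑ A : Finset (Fin n), (A.card : ℝ) ^ α * β A := by
    rw [← trace_numberPow_mul, ← hb, Matrix.trace_mul_comm, hm, star_mul, star_pow, star_mul,
      star_star, pow_succ, mul_assoc]
  have hint : ∫ θ in (0 : ℝ)..(Real.pi / 2), weight α θ *
      (K * (2 ^ n * ∑ A : Finset (Fin n),
        (A.card * (Real.sin θ * Real.cos θ ^ (A.card - 1))) * β A)) =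
      K * 2 ^ n * (Real.Gamma (1 - α) * m) := by
    have e : ∀ θ : ℝ, weight α θ * (K * (2 ^ n * ∑ A : Finset (Fin n),
        (A.card * (Real.sin θ * Real.cos θ ^ (A.card - 1))) * β A)) =
        K * 2 ^ n * ∑ A : Finset (Fin n),
          weight α θ * (A.card * (Real.sin θ * Real.cos θ ^ (A.card - 1))) * β A := by
      intro θ
      simp only [Finset.mul_sum]
      exact Finset.sum_congr rfl fun A _ => by ring
    simp only [e]
    rw [intervalIntegral.integral_const_mul, intervalIntegral.integral_finsetSum]
    · simp only [intervalIntegral.integral_mul_const]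
      rw [hm', Finset.mul_sum _ _ (Real.Gamma (1 - α))]
      congr 1
      refine Finset.sum_congr rfl fun A _ => ?_
      rw [integral_weight_mul h0 (by linarith), mul_assoc]
    · intro A _
      exact (hw.mul_continuousOn (by fun_prop)).mul_const _
  have hle : ∫ θ in (0 : ℝ)..(Real.pi / 2), weight α θ *
      (K * (2 ^ n * ∑ A : Finset (Fin n),
        (A.card * (Real.sin θ * Real.cos θ ^ (A.card - 1))) * β A)) ≤
      ∫ θ in (0 : ℝ)..(Real.pi / 2), weight α θ * C := by
    refine intervalIntegral.integral_mono_on (by positivity) (hw.mul_continuousOn (by fun_prop))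
      (hw.mul_const _) fun θ _ => ?_
    exact mul_le_mul_of_nonneg_left (trace_rotate_gradient_le θ K T b p) (weight_nonneg α θ)
  rw [hint, intervalIntegral.integral_mul_const, gamma_mul_constK (by linarith), ← hK] at hle
  -- With this choice of scale both sides carry the factor `Γ(1-α) K`.
  have h2 : 2 ^ n * m ≤ C := by
    refine le_of_mul_le_mul_left (a := Real.Gamma (1 - α) * K) ?_ (by positivity)
    linarith
  -- Of the `2p+2` copies of `2^n m` on the left, `2p+1` are absorbed by Young's second term.
  rw [hC, le_div_iff₀ (by positivity)] at h2
  linarith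

theorem numberPow_moment_le {α : ℝ} (h0 : 0 < α) (h1 : α < 1 / 2) (T : Mat n) (p : ℕ) :
    ((star (numberPow α T) * numberPow α T) ^ p).trace.re ≤
      gaussianMoment p * (constK α ^ 2 * normInf (gradNorm T) ^ 2) ^ p * 2 ^ n := by
  cases p with
  | zero => simp only [pow_zero, trace_one_re, gaussianMoment_zero]; simp
  | succ p =>
    have h2 := numberPow_moment_succ_le h0 h1 T p
    have h3 := mul_le_mul_of_nonneg_left (gradient_moment_le T (p + 1))
      (pow_nonneg (constK_pos h0 h1).le (2 * (p + 1)))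
    refine le_of_mul_le_mul_left (a := (2 : ℝ) ^ n) ((h2.trans h3).trans (le_of_eq ?_))
      (by positivity)
    rw [mul_pow (constK α ^ 2), pow_mul]
    ring

theorem tail_numberPow {α : ℝ} (h0 : 0 < α) (h1 : α < 1 / 2) (T : Mat n) {t : ℝ} (ht : 0 ≤ t) :
    (tau (specProj t (CFC.abs (numberPow α T)))).re ≤
        2 * Real.exp (-(t ^ 2 / (2 * constK α ^ 2 * normInf (gradNorm T) ^ 2))) ∧
      (normInf (gradNorm T) = 0 → 0 < t → tau (specProj t (CFC.abs (numberPow α T))) = 0) := by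
  have h := tail_of_moments (v := constK α ^ 2 * normInf (gradNorm T) ^ 2) (by positivity)
    (numberPow_moment_le h0 h1 T) ht
  rw [← mul_assoc] at h
  exact ⟨h.1, fun hz => h.2 (by rw [hz]; simp)⟩

end CAR

theorem corollary6p7 (n : ℕ) (T : CAR.Mat n) (hT : T ∈ CAR.algebra n) :
    (∀ t : ℝ, 0 ≤ t →
      (CAR.tau (CAR.specProj t (CFC.abs (T - CAR.tau T • (1 : CAR.Mat n))))).re ≤
          2 * Real.exp (-(4 * t ^ 2 / (Real.pi ^ 2 * CAR.normInf (CAR.gradNorm T) ^ 2))) ∧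
        (CAR.normInf (CAR.gradNorm T) = 0 → 0 < t →
          CAR.tau (CAR.specProj t (CFC.abs (T - CAR.tau T • (1 : CAR.Mat n)))) = 0)) ∧
    (∀ α : ℝ, 0 < α → α < 1 / 2 →
      IntervalIntegrable (CAR.weight α) MeasureTheory.volume 0 (Real.pi / 2) ∧
      ∀ t : ℝ, 0 ≤ t →
        (CAR.tau (CAR.specProj t (CFC.abs (CAR.numberPow α T)))).re ≤
            2 * Real.exp (-(t ^ 2 /
              (2 * CAR.constK α ^ 2 * CAR.normInf (CAR.gradNorm T) ^ 2))) ∧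
          (CAR.normInf (CAR.gradNorm T) = 0 → 0 < t →
            CAR.tau (CAR.specProj t (CFC.abs (CAR.numberPow α T))) = 0)) :=
  ⟨fun _ ht => CAR.tail_sub_tau hT ht, fun _ h0 h1 =>
    ⟨CAR.intervalIntegrable_weight h0 h1, fun _ ht => CAR.tail_numberPow h0 h1 T ht⟩⟩
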